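/- **Theorem 2.** For $m\in\{0,1,2,\dots\}$ let $$V_m(x)=\frac1{m!}\int_0^\infty \frac{s^{2m}e^{-s^2}}{\sqrt{x^2+s^2}}\,s\,ds ,\qquad V_{-1}(x)=\frac1{|x|}.$$ For $N$ particles on the line, $Z\ge 1$, $B>0$ and real measurable potentials $\widetilde V_j$ ($1\le j\le N$) and $\widetilde W_{jk}$ ($1\le j<k\le N$), with $\widetilde V_j\in L^1_{\rm loc}(\mathbb R)$ and $\widetilde W_{jk}\in L^1_{\rm loc}(\mathbb R\setminus\{0\})$, consider $$h=\sum_{j=1}^N\Big[-\frac1M\frac{d^2}{dx_j^2}-Z\,\widetilde V_j(x_j)\Big]+\sum_{j<k}\widetilde W_{jk}(x_j-x_k),\qquad M=B^{-1/2}.$$ Let $E_0(N)=\inf\langle\Phi,h\Phi\rangle$, the infimum being over normalized $\Phi\in C_c^\infty(\mathbb R^N;\mathbb C)$ with finite potential energy, and let $E_0^{(k)}(N-1)$ be the corresponding ground state energy of the $(N-1)$-particle Hamiltonian obtained from $h$ by omitting all terms involving $x_k$ (for identical potentials it does not depend on $k$). We say that $h$ has a bound state if $E_0(N)<E_0^{(k)}(N-1)$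 for every $k$. Let $K,\gamma\in\mathbb R$. There are constants $A,a_2>0$ depending only on $K$ and $\gamma$, and for every $\epsilon>0$ a constant $a_\epsilon>0$ depending only on $K,\gamma,\epsilon$, such that the following holds for all integers $N\ge 0$, $\mu\ge0$, $0\le\nu\le2\mu$, all real $Z\ge1$ and $B$, and all potentials as above. Suppose that $$\widetilde V_j(x)\le V_\mu(x)\quad\text{and}\quad \widetilde W_{jk}(x)\ge \tfrac1{\sqrt2}V_{\nu-1}\big(\tfrac{x}{\sqrt2}\big)\qquad\text{for all } j,\ \text{all } j<k \text{ and all } x$$ (only $x\neq0$ in the second bound), and that either $\nu\le K$ and $\gamma>2$, or $\nu\le KN$ and $\gamma>3$. If $$N>3Z+1+A\,Z\log Z\,\Big|\log\frac{Z^2}{B}\Big|\qquad\text{and}\qquad a_\epsilon e^{Z^{1/2-\epsilon}}>B\ge a_2Z^{\gamma},$$ then $h$ has no bound state. -/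

import Mathlib

open MeasureTheory
open scoped ContDiff

noncomputable section

namespace LandauModel

/-- The regularized Coulomb potential
`V_m(x) = (1/m!) ∫₀^∞ s^{2m} e^{-s²} / √(x² + s²) s ds` of the `m`-th Landau state. -/
def V (m : ℕ) (x : ℝ) : ℝ :=
  (1 / (m.factorial : ℝ)) *
    ∫ s in Set.Ioi (0 : ℝ), s ^ (2 * m) * Real.exp (-s ^ 2) / Real.sqrt (x ^ 2 + s ^ 2) * s

/-- `VPred ν = V_{ν-1}`.  For `ν = 0` this is the unregularized Coulomb potential `1/|x|`, the limit
of `V_m` (with `Γ(m+1)` in place of `m!`) as the real parameter `m` decreases to `-1`. -/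
def VPred : ℕ → ℝ → ℝ
  | 0, x => 1 / |x|
  | m + 1, x => V m x

section Hamiltonian

variable {ι : Type} [Fintype ι] [LinearOrder ι]

/-- The potential `-Z ∑_j V_j(x_j) + ∑_{j<k} W_{jk}(x_j - x_k)` on the configuration space
of the particles labelled by `ι`. -/
def potential (Z : ℝ) (Vt : ι → ℝ → ℝ) (Wt : ι → ι → ℝ → ℝ) (x : ι → ℝ) : ℝ :=
  (∑ j, -Z * Vt j (x j)) + ∑ j, ∑ k ∈ Finset.univ.filter (fun k => j < k), Wt j k (x j - x k)

/-- The quadratic form `⟨Φ, h Φ⟩` of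
`h = ∑_j [-(1/M) d²/dx_j² - Z V_j(x_j)] + ∑_{j<k} W_{jk}(x_j - x_k)`. -/
def energy (M Z : ℝ) (Vt : ι → ℝ → ℝ) (Wt : ι → ι → ℝ → ℝ) (Φ : (ι → ℝ) → ℂ) : ℝ :=
  ∫ x, ((1 / M) * ∑ j, ‖fderiv ℝ Φ x (Pi.single j 1)‖ ^ 2
    + potential Z Vt Wt x * ‖Φ x‖ ^ 2)

/-- Normalized smooth compactly supported wave functions of finite potential energy. -/
structure IsTrial (Z : ℝ) (Vt : ι → ℝ → ℝ) (Wt : ι → ι → ℝ → ℝ) (Φ : (ι → ℝ) → ℂ) : Prop where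
  contDiff : ContDiff ℝ ∞ Φ
  hasCompactSupport : HasCompactSupport Φ
  integrable : Integrable (fun x => potential Z Vt Wt x * ‖Φ x‖ ^ 2)
  norm_eq_one : ∫ x, ‖Φ x‖ ^ 2 = 1

/-- The ground state energy `inf_{‖Φ‖ = 1} ⟨Φ, h Φ⟩`, valued in the extended reals so that no
junk value can occur.  For an empty `ι` it is `0`. -/
def groundEnergy (M Z : ℝ) (Vt : ι → ℝ → ℝ) (Wt : ι → ι → ℝ → ℝ) : EReal :=
  ⨅ (Φ : (ι → ℝ) → ℂ) (_ : IsTrial Z Vt Wt Φ), (energy M Z Vt Wt Φ : EReal)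

/-- The ground state energy of the Hamiltonian obtained by omitting all terms that involve `x_k`. -/
def groundEnergyWithout (M Z : ℝ) (Vt : ι → ℝ → ℝ) (Wt : ι → ι → ℝ → ℝ) (k : ι) : EReal :=
  groundEnergy (ι := {j : ι // j ≠ k}) M Z (fun j => Vt j) (fun i j => Wt i j)

/-- `h` has a bound state: its ground state energy lies strictly below the ground state energy
that is left after removing any one of the particles, `E₀(N) < E₀(N-1)`. -/
def HasBoundState (M Z : ℝ) (Vt : ι → ℝ → ℝ) (Wt : ι → ι → ℝ → ℝ) : Prop :=
  ∀ k : ι, groundEnergy M Z Vt Wt < groundEnergyWithout M Z Vt Wt k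

end Hamiltonian

end LandauModel

end

/-!
The trial function in the `N`-particle form is `√S · Ψ` with `S = ∑ₖ w(xₖ)` and
`w(x) = √(R² + x²)`; it decomposes into the pieces `√w(xₖ) · Ψ`, and the localization error at
`xₖ` is only `(w')²/(4w) ≤ 1/(4R)`. In the `k`-th piece the other `N - 1` particles contribute at
least their own ground state energy, so there is no bound state as soon as the terms involving
`xₖ`, weighted by `w(xₖ)` and summed over `k`, outweigh the localization errors.

Since `-ψ'' ≥ (g' - g²)ψ` for every `g`, the kinetic energy of the `k`-th particle absorbs the
attraction for `g = 2ZM · arsinh`, cut off at distance `R`, up to a weighted cost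
`O(Z log R) + O(Z² R M log² R)` per particle. The repulsion has no such loss: by the triangle
inequality `w(x) + w(y)` dominates `√((x - y)² + 2ν)` once `R` exceeds `√ν`, so each pair
contributes at least `1/2`, in total `N(N - 1)/4`. The choice `R = 4√B/N + 1 + √ν` balances the
localization error against the remaining terms.
-/

noncomputable section

namespace LandauModel

section LocalizationError

variable {E F : Type*} [NormedAddCommGroup E] [NormedSpace ℝ E]
  [NormedAddCommGroup F] [InnerProductSpace ℝ F]

lemma contDiff_sqrt_smul {w : E → ℝ} {Φ : E → F} {n : WithTop ℕ∞} (hw : ContDiff ℝ n w)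
    (hpos : ∀ x, 0 < w x) (hΦ : ContDiff ℝ n Φ) : ContDiff ℝ n fun x => √(w x) • Φ x :=
  (hw.sqrt fun x => (hpos x).ne').smul hΦ

lemma norm_fderiv_sqrt_smul_sq {w : E → ℝ} {Ψ : E → F} {x : E} (hw : DifferentiableAt ℝ w x)
    (hwx : 0 < w x) (hΨ : DifferentiableAt ℝ Ψ x) (v : E) :
    ‖fderiv ℝ (fun y => √(w y) • Ψ y) x v‖ ^ 2 =
      w x * ‖fderiv ℝ Ψ x v‖ ^ 2 + fderiv ℝ w x v * inner ℝ (fderiv ℝ Ψ x v) (Ψ x)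
        + fderiv ℝ w x v ^ 2 / (4 * w x) * ‖Ψ x‖ ^ 2 := by
  have hsqrt : √(w x) ^ 2 = w x := Real.sq_sqrt hwx.le
  have hne : √(w x) ≠ 0 := (Real.sqrt_pos.2 hwx).ne'
  have hderiv : fderiv ℝ (fun y => √(w y) • Ψ y) x v =
      √(w x) • fderiv ℝ Ψ x v + (fderiv ℝ w x v / (2 * √(w x))) • Ψ x := by
    rw [fderiv_fun_smul (hw.sqrt hwx.ne') hΨ, fderiv_sqrt hw hwx.ne']
    simp only [add_apply, smul_apply, ContinuousLinearMap.smulRight_apply, smul_eq_mul]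
    congr 2
    ring
  rw [hderiv, norm_add_sq_real, norm_smul, norm_smul, inner_smul_left, inner_smul_right, mul_pow,
    mul_pow, Real.norm_eq_abs, Real.norm_eq_abs, sq_abs, sq_abs, div_pow, mul_pow, hsqrt]
  simp only [conj_trivial]
  field_simp
  ring

lemma sum_norm_fderiv_sqrt_smul_sq_le {κ : Type*} [Fintype κ] [Nonempty κ] {w : κ → E → ℝ}
    {Ψ : E → F} {x : E} (hw : ∀ k, DifferentiableAt ℝ (w k) x) (hwx : ∀ k, 0 < w k x)
    (hΨ : DifferentiableAt ℝ Ψ x) (v : E) :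
    ∑ k, ‖fderiv ℝ (fun y => √(w k y) • Ψ y) x v‖ ^ 2 ≤
      ‖fderiv ℝ (fun y => √(∑ k, w k y) • Ψ y) x v‖ ^ 2
        + (∑ k, fderiv ℝ (w k) x v ^ 2 / (4 * w k x)) * ‖Ψ x‖ ^ 2 := by
  have hsum : 0 < ∑ k, w k x := Finset.sum_pos (fun k _ => hwx k) Finset.univ_nonempty
  have hfderiv : fderiv ℝ (fun y => ∑ k, w k y) x v = ∑ k, fderiv ℝ (w k) x v := by
    rw [fderiv_fun_sum (fun k _ => hw k), sum_apply]
  rw [norm_fderiv_sqrt_smul_sq (.fun_sum fun k _ => hw k) hsum hΨ, hfderiv,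
    Finset.sum_congr rfl fun k _ => norm_fderiv_sqrt_smul_sq (hw k) (hwx k) hΨ v,
    Finset.sum_add_distrib, Finset.sum_add_distrib, ← Finset.sum_mul, ← Finset.sum_mul,
    ← Finset.sum_mul]
  have : 0 ≤ (∑ k, fderiv ℝ (w k) x v) ^ 2 / (4 * ∑ k, w k x) * ‖Ψ x‖ ^ 2 := by positivity
  linarith

end LocalizationError

section QuadraticForms

variable {E F : Type*} [MeasureSpace E] [NormedAddCommGroup F]

/-- The expectation `∫ U |Φ|²` of the multiplication operator `U`. -/
def expect (U : E → ℝ) (Φ : E → F) : ℝ := ∫ x, U x * ‖Φ x‖ ^ 2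

lemma expect_const_smul [NormedSpace ℝ F] (c : ℝ) (U : E → ℝ) (Φ : E → F) :
    expect U (fun x => c • Φ x) = c ^ 2 * expect U Φ := by
  simp only [expect, norm_smul, mul_pow, Real.norm_eq_abs, sq_abs, ← integral_const_mul]
  exact integral_congr_ae (.of_forall fun x => by ring)

variable [NormedAddCommGroup E] [BorelSpace E]

lemma integrable_mul_norm_smul_sq [NormedSpace ℝ F] {U c : E → ℝ} {Φ : E → F}
    (hU : Integrable fun x => U x * ‖Φ x‖ ^ 2) (hc : Continuous c) (hΦ : HasCompactSupport Φ) :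
    Integrable fun x => U x * ‖c x • Φ x‖ ^ 2 := by
  have hsupp : Function.support (fun x => c x ^ 2 * (U x * ‖Φ x‖ ^ 2)) ⊆ tsupport Φ := by
    refine fun x hx => subset_tsupport Φ fun h => hx ?_
    simp [h]
  have hint := (integrableOn_iff_integrable_of_support_subset hsupp).1
    (hU.integrableOn.continuousOn_mul (hc.pow 2).continuousOn hΦ)
  refine hint.congr (.of_forall fun x => ?_)
  simp only [norm_smul, mul_pow, Real.norm_eq_abs, sq_abs]
  ring

variable [IsFiniteMeasureOnCompacts (volume : Measure E)]

lemma integrable_mul_norm_sq {U : E → ℝ} {Φ : E → F} (hU : Continuous U) (hΦ : Continuous Φ)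
    (hΦc : HasCompactSupport Φ) : Integrable fun x => U x * ‖Φ x‖ ^ 2 := by
  have hnorm : HasCompactSupport fun x => ‖Φ x‖ ^ 2 :=
    hΦc.comp_left (g := fun z => ‖z‖ ^ 2) (by simp)
  have hcont : Continuous fun x => ‖Φ x‖ ^ 2 := hΦ.norm.pow 2
  exact (hU.mul hcont).integrable_of_hasCompactSupport hnorm.mul_left

variable [NormedSpace ℝ E] [InnerProductSpace ℝ F]

/-- The kinetic form `∫ |∂_v Φ|²` in the direction `v`. -/
def kinetic (v : E) (Φ : E → F) : ℝ := ∫ x, ‖fderiv ℝ Φ x v‖ ^ 2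

lemma integrable_norm_fderiv_sq {Φ : E → F} (hΦ : ContDiff ℝ 1 Φ) (hΦc : HasCompactSupport Φ)
    (v : E) : Integrable fun x => ‖fderiv ℝ Φ x v‖ ^ 2 := by
  simpa only [one_mul] using integrable_mul_norm_sq (continuous_const (y := (1 : ℝ)))
    ((hΦ.continuous_fderiv one_ne_zero).clm_apply continuous_const) (hΦc.fderiv_apply ℝ v)

lemma sum_kinetic_sqrt_smul_le {κ : Type*} [Fintype κ] [Nonempty κ] {w : κ → E → ℝ} {Ψ : E → F}
    (hw : ∀ k, ContDiff ℝ 1 (w k)) (hpos : ∀ k x, 0 < w k x) (hΨ : ContDiff ℝ 1 Ψ)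
    (hΨc : HasCompactSupport Ψ) (v : E) :
    ∑ k, kinetic v (fun x => √(w k x) • Ψ x) ≤ kinetic v (fun x => √(∑ k, w k x) • Ψ x)
      + expect (fun x => ∑ k, fderiv ℝ (w k) x v ^ 2 / (4 * w k x)) Ψ := by
  have hsum : ∀ x, 0 < ∑ k, w k x :=
    fun x => Finset.sum_pos (fun k _ => hpos k x) Finset.univ_nonempty
  have hint : ∀ {u : E → ℝ}, ContDiff ℝ 1 u → (∀ x, 0 < u x) →
      Integrable fun x => ‖fderiv ℝ (fun y => √(u y) • Ψ y) x v‖ ^ 2 := fun hu hu0 =>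
    integrable_norm_fderiv_sq (contDiff_sqrt_smul hu hu0 hΨ) hΨc.smul_left v
  have hpieces := fun k => hint (hw k) (hpos k)
  have hwhole := hint (ContDiff.sum fun k _ => hw k) hsum
  have herror : Integrable fun x => (∑ k, fderiv ℝ (w k) x v ^ 2 / (4 * w k x)) * ‖Ψ x‖ ^ 2 := by
    refine integrable_mul_norm_sq (continuous_finsetSum _ fun k _ => ?_) hΨ.continuous hΨc
    exact ((((hw k).continuous_fderiv one_ne_zero).clm_apply continuous_const).pow 2).div
      (continuous_const.mul (hw k).continuous) fun x => (mul_pos four_pos (hpos k x)).ne'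
  simp only [kinetic, expect]
  rw [← integral_finsetSum _ fun k _ => hpieces k, ← integral_add hwhole herror]
  exact integral_mono (integrable_finsetSum _ fun k _ => hpieces k) (hwhole.add herror) fun x =>
    sum_norm_fderiv_sqrt_smul_sq_le (fun k => (hw k).differentiable one_ne_zero x)
      (fun k => hpos k x) (hΨ.differentiable one_ne_zero x) v

end QuadraticForms

section Riccati

variable {E F : Type*} [NormedAddCommGroup E] [NormedSpace ℝ E] [FiniteDimensional ℝ E]
  [MeasureSpace E] [BorelSpace E] [(volume : Measure E).IsAddHaarMeasure]
  [NormedAddCommGroup F] [InnerProductSpace ℝ F]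

/-- Integrating `‖∂_v Ψ + G Ψ‖² ≥ 0`, the cross term being `G ∂_v ‖Ψ‖²`. -/
lemma expect_fderiv_sub_sq_le_kinetic {G : E → ℝ} {Ψ : E → F} (hG : ContDiff ℝ 1 G)
    (hΨ : ContDiff ℝ 1 Ψ) (hΨc : HasCompactSupport Ψ) (v : E) :
    expect (fun x => fderiv ℝ G x v - G x ^ 2) Ψ ≤ kinetic v Ψ := by
  have hρ : ContDiff ℝ 1 fun x => ‖Ψ x‖ ^ 2 := hΨ.norm_sq ℝ
  have hρc : HasCompactSupport fun x => ‖Ψ x‖ ^ 2 :=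
    hΨc.comp_left (g := fun z => ‖z‖ ^ 2) (by simp)
  have hfderivG : Integrable fun x => fderiv ℝ G x v * ‖Ψ x‖ ^ 2 := integrable_mul_norm_sq
    ((hG.continuous_fderiv one_ne_zero).clm_apply continuous_const) hΨ.continuous hΨc
  have hsqG : Integrable fun x => G x ^ 2 * ‖Ψ x‖ ^ 2 :=
    integrable_mul_norm_sq (hG.continuous.pow 2) hΨ.continuous hΨc
  have hcross : Integrable fun x => G x * fderiv ℝ (fun y => ‖Ψ y‖ ^ 2) x v :=
    (hG.continuous.mul ((hρ.continuous_fderiv one_ne_zero).clm_apply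
      continuous_const)).integrable_of_hasCompactSupport (hρc.fderiv_apply ℝ v).mul_left
  have hcrossneg : Integrable fun x => -(G x * fderiv ℝ (fun y => ‖Ψ y‖ ^ 2) x v) := hcross.neg
  have hparts := integral_mul_fderiv_eq_neg_fderiv_mul_of_integrable hfderivG hcross
    (integrable_mul_norm_sq hG.continuous hΨ.continuous hΨc)
    (fun x _ => hG.differentiable one_ne_zero x) fun x _ => hρ.differentiable one_ne_zero x
  calc expect (fun x => fderiv ℝ G x v - G x ^ 2) Ψ
      = ∫ x, (-(G x * fderiv ℝ (fun y => ‖Ψ y‖ ^ 2) x v) - G x ^ 2 * ‖Ψ x‖ ^ 2) := by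
        simp only [expect, sub_mul]
        rw [integral_sub hfderivG hsqG, integral_sub hcrossneg hsqG, integral_neg, hparts, neg_neg]
    _ ≤ kinetic v Ψ := by
        refine integral_mono (hcrossneg.sub hsqG) (integrable_norm_fderiv_sq hΨ hΨc v) fun x => ?_
        have hsq := norm_add_sq_real (fderiv ℝ Ψ x v) (G x • Ψ x)
        rw [norm_smul, inner_smul_right, mul_pow, Real.norm_eq_abs, sq_abs, real_inner_comm] at hsq
        have hfderiv : fderiv ℝ (fun y => ‖Ψ y‖ ^ 2) x v = 2 * inner ℝ (Ψ x) (fderiv ℝ Ψ x v) := by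
          simp [(hΨ.differentiable one_ne_zero x).hasFDerivAt.norm_sq.fderiv]
        simp only [hfderiv]
        nlinarith [sq_nonneg ‖fderiv ℝ Ψ x v + G x • Ψ x‖]

end Riccati

section Energy

variable {ι : Type} [Fintype ι] [LinearOrder ι] {M Z e : ℝ} {Vt : ι → ℝ → ℝ}
  {Wt : ι → ι → ℝ → ℝ}

lemma kinetic_const_smul {E F : Type*} [NormedAddCommGroup E] [NormedSpace ℝ E] [MeasureSpace E]
    [NormedAddCommGroup F] [InnerProductSpace ℝ F] (c : ℝ) {Φ : E → F} (hΦ : Differentiable ℝ Φ)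
    (v : E) : kinetic v (fun x => c • Φ x) = c ^ 2 * kinetic v Φ := by
  simp only [kinetic, ← integral_const_mul]
  refine integral_congr_ae (.of_forall fun x => ?_)
  simp only [fderiv_fun_const_smul (hΦ x), smul_apply, norm_smul, mul_pow, Real.norm_eq_abs, sq_abs]

lemma energy_eq_kinetic_add_expect {Φ : (ι → ℝ) → ℂ} (hΦ : ContDiff ℝ 1 Φ)
    (hΦc : HasCompactSupport Φ) (hint : Integrable fun x => potential Z Vt Wt x * ‖Φ x‖ ^ 2) :
    energy M Z Vt Wt Φ =
      (1 / M) * ∑ j, kinetic (Pi.single j 1) Φ + expect (potential Z Vt Wt) Φ := by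
  have hkin : ∀ j, Integrable fun x => ‖fderiv ℝ Φ x (Pi.single j 1)‖ ^ 2 :=
    fun j => integrable_norm_fderiv_sq hΦ hΦc _
  simp only [energy, kinetic, expect]
  rw [integral_add ((integrable_finsetSum _ fun j _ => hkin j).const_mul _) hint,
    integral_const_mul, integral_finsetSum _ fun j _ => hkin j]

lemma energy_const_smul (c : ℝ) {Φ : (ι → ℝ) → ℂ} (hΦ : ContDiff ℝ 1 Φ)
    (hΦc : HasCompactSupport Φ) (hint : Integrable fun x => potential Z Vt Wt x * ‖Φ x‖ ^ 2) :
    energy M Z Vt Wt (fun x => c • Φ x) = c ^ 2 * energy M Z Vt Wt Φ := by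
  rw [energy_eq_kinetic_add_expect (hΦ.const_smul c) (hΦc.smul_left (f := fun _ => c))
    (integrable_mul_norm_smul_sq hint continuous_const hΦc),
    energy_eq_kinetic_add_expect hΦ hΦc hint, expect_const_smul,
    Finset.sum_congr rfl fun j _ => kinetic_const_smul c (hΦ.differentiable one_ne_zero) _,
    ← Finset.mul_sum]
  ring

lemma eq_zero_of_integral_norm_sq_eq_zero {Φ : (ι → ℝ) → ℂ} (hΦ : Continuous Φ)
    (hΦc : HasCompactSupport Φ) (h0 : ∫ x, ‖Φ x‖ ^ 2 = 0) : Φ = 0 := by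
  have hint : Integrable fun x => ‖Φ x‖ ^ 2 := by
    simpa only [one_mul] using integrable_mul_norm_sq (continuous_const (y := (1 : ℝ))) hΦ hΦc
  have hsq : (fun x => ‖Φ x‖ ^ 2) = 0 := ((hΦ.norm.pow 2).ae_eq_iff_eq volume continuous_zero).1
    ((integral_eq_zero_iff_of_nonneg (fun x => by positivity) hint).1 h0)
  exact funext fun x => by simpa using congrFun hsq x

lemma mul_integral_norm_sq_le_energy (he : (e : EReal) ≤ groundEnergy M Z Vt Wt)
    {Φ : (ι → ℝ) → ℂ} (hΦ : ContDiff ℝ ∞ Φ) (hΦc : HasCompactSupport Φ)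
    (hint : Integrable fun x => potential Z Vt Wt x * ‖Φ x‖ ^ 2) :
    e * ∫ x, ‖Φ x‖ ^ 2 ≤ energy M Z Vt Wt Φ := by
  have hnonneg : 0 ≤ ∫ x, ‖Φ x‖ ^ 2 := integral_nonneg fun x => by positivity
  rcases hnonneg.eq_or_lt with h0 | hpos
  · rw [← h0, eq_zero_of_integral_norm_sq_eq_zero hΦ.continuous hΦc h0.symm]
    simp [energy]
  · set c := (√(∫ x, ‖Φ x‖ ^ 2))⁻¹
    have hc : c ^ 2 = (∫ x, ‖Φ x‖ ^ 2)⁻¹ := by rw [inv_pow, Real.sq_sqrt hnonneg]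
    have htrial : IsTrial Z Vt Wt fun x => c • Φ x :=
      { contDiff := hΦ.const_smul c
        hasCompactSupport := hΦc.smul_left (f := fun _ => c)
        integrable := integrable_mul_norm_smul_sq hint continuous_const hΦc
        norm_eq_one := by
          simp only [norm_smul, mul_pow, Real.norm_eq_abs, sq_abs]
          rw [integral_const_mul, hc, inv_mul_cancel₀ hpos.ne'] }
    have hle : e ≤ energy M Z Vt Wt fun x => c • Φ x :=
      EReal.coe_le_coe_iff.1 (he.trans (iInf₂_le _ htrial))
    rwa [energy_const_smul c (hΦ.of_le (mod_cast le_top)) hΦc hint, hc, inv_mul_eq_div,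
      le_div_iff₀ hpos] at hle

end Energy

section Insertion

variable {ι : Type*} [DecidableEq ι]

/-- The configuration whose `k`-th coordinate is `t` and whose other coordinates are `y`. -/
def insertAt (k : ι) (t : ℝ) (y : {j : ι // j ≠ k} → ℝ) : ι → ℝ :=
  (Homeomorph.funSplitAt ℝ k).symm (t, y)

lemma insertAt_self (k : ι) (t : ℝ) (y : {j : ι // j ≠ k} → ℝ) : insertAt k t y k = t := by
  simp [insertAt]

lemma insertAt_coe (k : ι) (t : ℝ) (y : {j : ι // j ≠ k} → ℝ) (j : {j : ι // j ≠ k}) :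
    insertAt k t y j = y j := by
  simp [insertAt, j.2]

lemma isClosedEmbedding_insertAt (k : ι) (t : ℝ) : Topology.IsClosedEmbedding (insertAt k t) :=
  (Homeomorph.funSplitAt ℝ k).symm.isClosedEmbedding.comp
    (.of_isEmbedding_isClosedMap (isEmbedding_prodMkRight t) (isClosedMap_prodMk_left t))

lemma insertAt_add_smul_single (k : ι) (t : ℝ) (y : {j : ι // j ≠ k} → ℝ)
    [DecidableEq {j : ι // j ≠ k}] (j : {j : ι // j ≠ k}) (s : ℝ) :
    insertAt k t (y + s • Pi.single j 1) = insertAt k t y + s • Pi.single (j : ι) 1 := by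
  funext i
  obtain rfl | hik := eq_or_ne i k
  · simp [insertAt_self, j.2.symm]
  · lift i to {i : ι // i ≠ k} using hik
    simp [insertAt_coe, Pi.single_apply, Subtype.ext_iff]

lemma contDiff_insertAt [Fintype ι] (k : ι) (t : ℝ) {n : WithTop ℕ∞} :
    ContDiff ℝ n (insertAt k t) := by
  refine contDiff_pi.2 fun i => ?_
  obtain rfl | hik := eq_or_ne i k
  · simpa only [insertAt_self] using contDiff_const
  · lift i to {i : ι // i ≠ k} using hik
    simpa only [insertAt_coe] using contDiff_apply ℝ ℝ i

lemma fderiv_comp_insertAt_single [Finite ι] {F : Type*} [NormedAddCommGroup F] [NormedSpace ℝ F]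
    {Φ : (ι → ℝ) → F} (hΦ : Differentiable ℝ Φ) (k : ι) (t : ℝ) (y : {j : ι // j ≠ k} → ℝ)
    [DecidableEq {j : ι // j ≠ k}] (j : {j : ι // j ≠ k}) :
    fderiv ℝ (fun y => Φ (insertAt k t y)) y (Pi.single j 1) =
      fderiv ℝ Φ (insertAt k t y) (Pi.single (j : ι) 1) := by
  cases nonempty_fintype ι
  have hcomp : Differentiable ℝ fun y => Φ (insertAt k t y) :=
    hΦ.comp ((contDiff_insertAt k t).differentiable one_ne_zero)
  rw [← (hcomp y).lineDeriv_eq_fderiv, ← (hΦ _).lineDeriv_eq_fderiv]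
  simp only [lineDeriv, insertAt_add_smul_single]

variable [Fintype ι]

lemma measurePreserving_funSplitAt (k : ι) : MeasurePreserving (Homeomorph.funSplitAt ℝ k) := by
  have hsplit := volume_preserving_piEquivPiSubtypeProd (fun _ : ι => ℝ) (· = k)
  refine MeasurePreserving.comp (g := Prod.map (MeasurableEquiv.funUnique {j // j = k} ℝ) id)
    (.prod ?_ (.id _)) hsplit
  convert volume_preserving_funUnique {j // j = k} ℝ <;> rfl

lemma integrable_comp_insertAt {f : (ι → ℝ) → ℝ} (k : ι) (hf : Integrable f) :
    Integrable fun p : ℝ × ({j : ι // j ≠ k} → ℝ) => f (insertAt k p.1 p.2) :=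
  (((measurePreserving_funSplitAt k).symm (Homeomorph.funSplitAt ℝ k).toMeasurableEquiv
    ).integrable_comp_emb (MeasurableEquiv.measurableEmbedding _)).2 hf

lemma integral_eq_integral_integral_insertAt {f : (ι → ℝ) → ℝ} (k : ι) (hf : Integrable f) :
    ∫ x, f x = ∫ t, ∫ y, f (insertAt k t y) :=
  (((measurePreserving_funSplitAt k).symm (Homeomorph.funSplitAt ℝ k).toMeasurableEquiv
    ).integral_comp' f).symm.trans (integral_prod _ (integrable_comp_insertAt k hf))

lemma integral_mono_of_ae_integral_insertAt_le {f g : (ι → ℝ) → ℝ} (k : ι) (hf : Integrable f)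
    (hg : Integrable g)
    (h : ∀ᵐ t : ℝ, ∫ y, f (insertAt k t y) ≤ ∫ y, g (insertAt k t y)) :
    ∫ x, f x ≤ ∫ x, g x := by
  rw [integral_eq_integral_integral_insertAt k hf, integral_eq_integral_integral_insertAt k hg]
  exact integral_mono_ae (integrable_comp_insertAt k hf).integral_prod_left
    (integrable_comp_insertAt k hg).integral_prod_left h

end Insertion

section Decomposition

variable {ι : Type} [LinearOrder ι] (Z : ℝ) (Vt : ι → ℝ → ℝ) (Wt : ι → ι → ℝ → ℝ)

/-- The interaction of the ordered pair `(j, l)`; each unordered pair is counted once, so that it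
vanishes unless `j < l`. -/
def pairPotential (j l : ι) (x : ι → ℝ) : ℝ :=
  if j < l then Wt j l (x j - x l) else 0

variable [Fintype ι]

/-- The part of the potential that involves the particle `k`. -/
def particlePotential (k : ι) (x : ι → ℝ) : ℝ :=
  -Z * Vt k (x k) + ∑ j, (pairPotential Wt k j x + pairPotential Wt j k x)

/-- The part of the potential that does not involve the particle `k`, as a function of the full
configuration. -/
def potentialWithout (k : ι) (x : ι → ℝ) : ℝ :=
  potential (ι := {j : ι // j ≠ k}) Z (fun j => Vt j) (fun i j => Wt i j) fun j => x j

lemma potential_eq_sum_pairPotential (x : ι → ℝ) :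
    potential Z Vt Wt x = (∑ j, -Z * Vt j (x j)) + ∑ j, ∑ l, pairPotential Wt j l x := by
  simp only [potential, Finset.sum_filter, pairPotential]

lemma potential_eq_potentialWithout_add_particlePotential (k : ι) (x : ι → ℝ) :
    potential Z Vt Wt x = potentialWithout Z Vt Wt k x + particlePotential Z Vt Wt k x := by
  have hself : pairPotential Wt k k x = 0 := if_neg (lt_irrefl k)
  have hwithout : potentialWithout Z Vt Wt k x = (∑ j : {j : ι // j ≠ k}, -Z * Vt j (x j)) +
      ∑ j : {j : ι // j ≠ k}, ∑ l : {j : ι // j ≠ k}, pairPotential Wt j l x := by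
    rw [potentialWithout, potential_eq_sum_pairPotential]
    rfl
  simp only [hwithout, potential_eq_sum_pairPotential, particlePotential,
    Fintype.sum_eq_add_sum_subtype_ne _ k, Finset.sum_add_distrib, hself]
  ring

end Decomposition

section Slicing

variable {ι : Type} [Fintype ι] [LinearOrder ι] {M Z e : ℝ} {Vt : ι → ℝ → ℝ}
  {Wt : ι → ι → ℝ → ℝ} {k : ι} {ψ : (ι → ℝ) → ℂ}

lemma potentialWithout_insertAt (t : ℝ) (y : {j : ι // j ≠ k} → ℝ) :
    potentialWithout Z Vt Wt k (insertAt k t y) =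
      potential (ι := {j : ι // j ≠ k}) Z (fun j => Vt j) (fun i j => Wt i j) y := by
  simp only [potentialWithout, insertAt_coe]

lemma mul_integral_norm_sq_insertAt_le (he : (e : EReal) ≤ groundEnergyWithout M Z Vt Wt k)
    (hψ : ContDiff ℝ ∞ ψ) (hψc : HasCompactSupport ψ) (t : ℝ)
    (hint : Integrable fun y =>
      potentialWithout Z Vt Wt k (insertAt k t y) * ‖ψ (insertAt k t y)‖ ^ 2) :
    e * ∫ y, ‖ψ (insertAt k t y)‖ ^ 2 ≤
      ∫ y, ((1 / M) * ∑ j : {j : ι // j ≠ k},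
          ‖fderiv ℝ ψ (insertAt k t y) (Pi.single (j : ι) 1)‖ ^ 2
        + potentialWithout Z Vt Wt k (insertAt k t y) * ‖ψ (insertAt k t y)‖ ^ 2) := by
  simp only [potentialWithout_insertAt,
    ← fderiv_comp_insertAt_single (hψ.differentiable (by simp))] at hint ⊢
  exact mul_integral_norm_sq_le_energy he (hψ.comp (contDiff_insertAt k t))
    (hψc.comp_isClosedEmbedding (isClosedEmbedding_insertAt k t)) hint

lemma mul_integral_norm_sq_le_of_le_groundEnergyWithout
    (he : (e : EReal) ≤ groundEnergyWithout M Z Vt Wt k) (hψ : ContDiff ℝ ∞ ψ)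
    (hψc : HasCompactSupport ψ)
    (hint : Integrable fun x => potentialWithout Z Vt Wt k x * ‖ψ x‖ ^ 2) :
    e * ∫ x, ‖ψ x‖ ^ 2 ≤ (1 / M) * ∑ j : {j : ι // j ≠ k}, kinetic (Pi.single (j : ι) 1) ψ
      + expect (potentialWithout Z Vt Wt k) ψ := by
  have hkin := fun j : {j : ι // j ≠ k} =>
    integrable_norm_fderiv_sq (hψ.of_le (mod_cast le_top)) hψc (Pi.single (j : ι) 1)
  have hkinsum := (integrable_finsetSum Finset.univ fun j _ => hkin j).const_mul (1 / M)
  have hslices := integral_mono_of_ae_integral_insertAt_le k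
    (integrable_mul_norm_sq (continuous_const (y := e)) hψ.continuous hψc) (hkinsum.fun_add hint)
    ((integrable_comp_insertAt k hint).prod_right_ae.mono fun t ht => by
      simpa only [integral_const_mul] using mul_integral_norm_sq_insertAt_le he hψ hψc t ht)
  rw [integral_const_mul, integral_add hkinsum hint, integral_const_mul,
    integral_finsetSum _ fun j _ => hkin j] at hslices
  exact hslices

end Slicing

section Integrability

lemma measurable_pairPotential {ι : Type} [LinearOrder ι] {Wt : ι → ι → ℝ → ℝ}
    (hWm : ∀ j l, j < l → Measurable (Wt j l)) (j l : ι) : Measurable (pairPotential Wt j l) := by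
  unfold pairPotential
  split_ifs with hjl
  · exact (hWm j l hjl).comp ((measurable_pi_apply j).sub (measurable_pi_apply l))
  · exact measurable_const

variable {ι : Type} [Fintype ι]

lemma ae_sub_ne_zero : ∀ᵐ x : ι → ℝ, ∀ j l, j ≠ l → x j - x l ≠ 0 := by
  classical
  refine ae_all_iff.2 fun j => ae_all_iff.2 fun l => ?_
  by_cases hjl : j = l
  · simp [hjl]
  set L : (ι → ℝ) →ₗ[ℝ] ℝ := .proj (φ := fun _ : ι => ℝ) j - .proj l with hL
  have hproper : LinearMap.ker L ≠ ⊤ := fun htop => by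
    have hmem : (Pi.single j 1 : ι → ℝ) ∈ LinearMap.ker L := htop ▸ Submodule.mem_top
    simp [hL, Ne.symm hjl] at hmem
  have hnull := Measure.addHaar_submodule volume _ hproper
  refine (measure_eq_zero_iff_ae_notMem.1 hnull).mono fun x hx _ hzero => hx ?_
  simpa [hL] using hzero

lemma locallyIntegrable_comp_eval {v : ℝ → ℝ} (hv : LocallyIntegrable v) (k : ι) :
    LocallyIntegrable fun x : ι → ℝ => v (x k) := by
  refine locallyIntegrable_iff.2 fun K hK => ?_
  obtain ⟨r, hr0, hr⟩ := hK.isBounded.subset_closedBall_lt 0 (0 : ι → ℝ)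
  refine IntegrableOn.mono_set ?_ hr
  rw [closedBall_pi _ hr0.le, IntegrableOn, volume_pi, Measure.restrict_pi_pi]
  have : ∀ i, IsFiniteMeasure (volume.restrict (Metric.closedBall ((0 : ι → ℝ) i) r)) :=
    fun i => isFiniteMeasure_restrict.2 measure_closedBall_lt_top.ne
  exact integrable_comp_eval (hv.integrableOn_isCompact (isCompact_closedBall _ _))

variable [LinearOrder ι] {Z : ℝ} {Vt : ι → ℝ → ℝ} {Wt : ι → ι → ℝ → ℝ} {Φ : (ι → ℝ) → ℂ}

lemma integrable_comp_eval_mul_norm_sq {v : ℝ → ℝ} (hv : LocallyIntegrable v) (k : ι)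
    (hΦ : Continuous Φ) (hΦc : HasCompactSupport Φ) : Integrable fun x => v (x k) * ‖Φ x‖ ^ 2 :=
  (locallyIntegrable_comp_eval hv k).integrable_smul_right_of_hasCompactSupport (hΦ.norm.pow 2)
    (hΦc.comp_left (g := fun z => ‖z‖ ^ 2) (by simp))

lemma ae_pairPotential_nonneg (hW : ∀ j l, j < l → ∀ t, t ≠ 0 → 0 ≤ Wt j l t) :
    ∀ᵐ x : ι → ℝ, ∀ j l, 0 ≤ pairPotential Wt j l x := by
  filter_upwards [ae_sub_ne_zero (ι := ι)] with x hx j l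
  unfold pairPotential
  split_ifs with hjl
  · exact hW j l hjl _ (hx j l hjl.ne)
  · exact le_rfl

lemma integrable_pairPotential_mul_norm_sq (hV : ∀ j, LocallyIntegrable (Vt j))
    (hWm : ∀ j l, j < l → Measurable (Wt j l)) (hW : ∀ j l, j < l → ∀ t, t ≠ 0 → 0 ≤ Wt j l t)
    (hΦ : Continuous Φ) (hΦc : HasCompactSupport Φ)
    (hint : Integrable fun x => potential Z Vt Wt x * ‖Φ x‖ ^ 2) (j l : ι) :
    Integrable fun x => pairPotential Wt j l x * ‖Φ x‖ ^ 2 := by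
  have hattraction : Integrable fun x => ∑ j, -Z * (Vt j (x j) * ‖Φ x‖ ^ 2) :=
    integrable_finsetSum _ fun j _ =>
      (integrable_comp_eval_mul_norm_sq (hV j) j hΦ hΦc).const_mul _
  have hrepulsion : Integrable fun x => (∑ j, ∑ l, pairPotential Wt j l x) * ‖Φ x‖ ^ 2 := by
    refine (hint.sub hattraction).congr (.of_forall fun x => ?_)
    simp only [Pi.sub_apply, potential_eq_sum_pairPotential, add_mul, Finset.sum_mul, mul_assoc]
    ring
  refine hrepulsion.mono' ((measurable_pairPotential hWm j l).aestronglyMeasurable.mul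
    (hΦ.norm.pow 2).aestronglyMeasurable) ?_
  filter_upwards [ae_pairPotential_nonneg hW] with x hx
  have hle : pairPotential Wt j l x ≤ ∑ j, ∑ l, pairPotential Wt j l x :=
    (Finset.single_le_sum (fun l _ => hx j l) (Finset.mem_univ l)).trans
      (Finset.single_le_sum (f := fun j => ∑ l, pairPotential Wt j l x)
        (fun j _ => Finset.sum_nonneg fun l _ => hx j l) (Finset.mem_univ j))
  rw [Real.norm_of_nonneg (mul_nonneg (hx j l) (by positivity))]
  exact mul_le_mul_of_nonneg_right hle (by positivity)

lemma integrable_particlePotential_mul_norm_sq (hV : ∀ j, LocallyIntegrable (Vt j))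
    (hWm : ∀ j l, j < l → Measurable (Wt j l)) (hW : ∀ j l, j < l → ∀ t, t ≠ 0 → 0 ≤ Wt j l t)
    (hΦ : Continuous Φ) (hΦc : HasCompactSupport Φ)
    (hint : Integrable fun x => potential Z Vt Wt x * ‖Φ x‖ ^ 2) (k : ι) :
    Integrable fun x => particlePotential Z Vt Wt k x * ‖Φ x‖ ^ 2 := by
  have hpair := integrable_pairPotential_mul_norm_sq hV hWm hW hΦ hΦc hint
  simp only [particlePotential, add_mul, mul_assoc, Finset.sum_mul]
  exact ((integrable_comp_eval_mul_norm_sq (hV k) k hΦ hΦc).const_mul _).add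
    (integrable_finsetSum _ fun j _ => (hpair k j).add (hpair j k))

end Integrability

section Expectation

variable {E F : Type*} [MeasureSpace E] [NormedAddCommGroup F]

lemma expect_const_mul (c : ℝ) (U : E → ℝ) (Φ : E → F) :
    expect (fun x => c * U x) Φ = c * expect U Φ := by
  simp only [expect, mul_assoc, integral_const_mul]

lemma expect_add {U V : E → ℝ} {Φ : E → F} (hU : Integrable fun x => U x * ‖Φ x‖ ^ 2)
    (hV : Integrable fun x => V x * ‖Φ x‖ ^ 2) :
    expect (fun x => U x + V x) Φ = expect U Φ + expect V Φ := by
  simp only [expect, add_mul, integral_add hU hV]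

lemma expect_sum {κ : Type*} [Fintype κ] {U : κ → E → ℝ} {Φ : E → F}
    (hU : ∀ k, Integrable fun x => U k x * ‖Φ x‖ ^ 2) :
    expect (fun x => ∑ k, U k x) Φ = ∑ k, expect (U k) Φ := by
  simp only [expect, Finset.sum_mul, integral_finsetSum _ fun k _ => hU k]

variable [NormedSpace ℝ F]

lemma mul_norm_sqrt_smul_sq {w : ℝ} (hw : 0 ≤ w) (u : ℝ) (z : F) :
    u * ‖√w • z‖ ^ 2 = w * u * ‖z‖ ^ 2 := by
  rw [norm_smul, mul_pow, Real.norm_eq_abs, sq_abs, Real.sq_sqrt hw]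
  ring

lemma expect_sqrt_smul {w : E → ℝ} (hw : ∀ x, 0 ≤ w x) (U : E → ℝ) (Φ : E → F) :
    expect U (fun x => √(w x) • Φ x) = expect (fun x => w x * U x) Φ := by
  simp only [expect, mul_norm_sqrt_smul_sq (hw _)]

variable {κ : Type*} [Fintype κ] {w : κ → E → ℝ} {Φ : E → F}

lemma sum_expect_sqrt_smul {U : E → ℝ} (hw : ∀ k x, 0 ≤ w k x)
    (hU : ∀ k, Integrable fun x => U x * ‖√(w k x) • Φ x‖ ^ 2) :
    ∑ k, expect U (fun x => √(w k x) • Φ x) = expect U (fun x => √(∑ k, w k x) • Φ x) := by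
  have hsum : ∀ x, 0 ≤ ∑ k, w k x := fun x => Finset.sum_nonneg fun k _ => hw k x
  simp only [expect_sqrt_smul (hw _), mul_norm_sqrt_smul_sq (hw _ _)] at hU ⊢
  rw [← expect_sum hU, expect_sqrt_smul hsum]
  simp only [Finset.sum_mul]

lemma expect_le_sum_expect_sqrt_smul {A : E → ℝ} {U : κ → E → ℝ} (hw : ∀ k x, 0 ≤ w k x)
    (hA : Integrable fun x => A x * ‖Φ x‖ ^ 2)
    (hU : ∀ k, Integrable fun x => U k x * ‖√(w k x) • Φ x‖ ^ 2)
    (hle : ∀ᵐ x, A x ≤ ∑ k, w k x * U k x) :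
    expect A Φ ≤ ∑ k, expect (U k) (fun x => √(w k x) • Φ x) := by
  simp only [expect_sqrt_smul (hw _), mul_norm_sqrt_smul_sq (hw _ _)] at hU ⊢
  rw [← expect_sum hU]
  refine integral_mono_ae hA ?_ (hle.mono fun x hx => mul_le_mul_of_nonneg_right hx (by positivity))
  simpa only [Finset.sum_mul] using integrable_finsetSum _ fun k _ => hU k

end Expectation

section Coordinates

variable {ι : Type*}

lemma contDiff_comp_eval [Fintype ι] {f : ℝ → ℝ} {n : WithTop ℕ∞} (hf : ContDiff ℝ n f) (k : ι) :
    ContDiff ℝ n fun x : ι → ℝ => f (x k) :=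
  hf.comp (contDiff_apply ℝ ℝ k)

lemma fderiv_comp_eval_single [Finite ι] [DecidableEq ι] {f : ℝ → ℝ} {x : ι → ℝ} {k : ι}
    (hf : DifferentiableAt ℝ f (x k)) (j : ι) :
    fderiv ℝ (fun x : ι → ℝ => f (x k)) x (Pi.single j 1) = if k = j then deriv f (x k) else 0 := by
  cases nonempty_fintype ι
  have hcomp : HasFDerivAt (fun x : ι → ℝ => f (x k)) _ x :=
    hf.hasDerivAt.comp_hasFDerivAt x (hasFDerivAt_apply (𝕜 := ℝ) (F' := fun _ : ι => ℝ) k x)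
  rw [hcomp.fderiv]
  simp [Pi.single_apply]

lemma continuous_deriv_sq_div {w : ℝ → ℝ} (hw : ContDiff ℝ 1 w) (hpos : ∀ s, 0 < w s)
    (j : ι) :
    Continuous fun x : ι → ℝ => deriv w (x j) ^ 2 / (4 * w (x j)) :=
  (((hw.continuous_deriv le_rfl).pow 2).div (continuous_const.mul hw.continuous)
    fun s => (mul_pos four_pos (hpos s)).ne').comp (continuous_apply j)

end Coordinates

section Localization

variable {ι : Type} [Fintype ι] [Nonempty ι] [LinearOrder ι] {M Z : ℝ} {Vt : ι → ℝ → ℝ}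
  {Wt : ι → ι → ℝ → ℝ} {w : ℝ → ℝ} {Ψ : (ι → ℝ) → ℂ}

lemma sum_kinetic_sqrt_comp_eval_smul_le (hw : ContDiff ℝ 1 w) (hpos : ∀ s, 0 < w s)
    (hΨ : ContDiff ℝ 1 Ψ) (hΨc : HasCompactSupport Ψ) (j : ι) :
    ∑ k, kinetic (Pi.single j 1) (fun x => √(w (x k)) • Ψ x) ≤
      kinetic (Pi.single j 1) (fun x => √(∑ k, w (x k)) • Ψ x)
        + expect (fun x => deriv w (x j) ^ 2 / (4 * w (x j))) Ψ := by
  have hkinetic := sum_kinetic_sqrt_smul_le (fun k : ι => contDiff_comp_eval hw k)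
    (fun k x => hpos (x k)) hΨ hΨc (Pi.single j 1)
  simpa [fderiv_comp_eval_single (hw.differentiable one_ne_zero _), ite_pow, ite_div] using hkinetic

lemma sum_energy_sqrt_comp_eval_smul_le (hM : 0 < M) (hw : ContDiff ℝ 1 w) (hpos : ∀ s, 0 < w s)
    (hΨ : ContDiff ℝ 1 Ψ) (hΨc : HasCompactSupport Ψ)
    (hint : Integrable fun x => potential Z Vt Wt x * ‖Ψ x‖ ^ 2) :
    ∑ k, energy M Z Vt Wt (fun x => √(w (x k)) • Ψ x) ≤
      energy M Z Vt Wt (fun x => √(∑ k, w (x k)) • Ψ x)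
        + expect (fun x => (1 / M) * ∑ j, deriv w (x j) ^ 2 / (4 * w (x j))) Ψ := by
  have hwk := fun k : ι => contDiff_comp_eval hw k
  have hS : ContDiff ℝ 1 fun x : ι → ℝ => ∑ k, w (x k) := ContDiff.sum fun k _ => hwk k
  have hS0 : ∀ x : ι → ℝ, 0 < ∑ k, w (x k) :=
    fun x => Finset.sum_pos (fun k _ => hpos _) Finset.univ_nonempty
  have hpiece : ∀ {u : (ι → ℝ) → ℝ}, Continuous u →
      Integrable fun x => potential Z Vt Wt x * ‖√(u x) • Ψ x‖ ^ 2 :=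
    fun hu => integrable_mul_norm_smul_sq hint hu.sqrt hΨc
  have henergy : ∀ {u : (ι → ℝ) → ℝ}, ContDiff ℝ 1 u → (∀ x, 0 < u x) →
      energy M Z Vt Wt (fun x => √(u x) • Ψ x) =
        (1 / M) * ∑ j, kinetic (Pi.single j 1) (fun x => √(u x) • Ψ x)
          + expect (potential Z Vt Wt) (fun x => √(u x) • Ψ x) := fun {u} hu hu0 =>
    energy_eq_kinetic_add_expect (contDiff_sqrt_smul hu hu0 hΨ)
      (hΨc.smul_left (f := fun x => √(u x))) (hpiece hu.continuous)
  rw [Finset.sum_congr rfl fun k _ => henergy (hwk k) fun x => hpos (x k), henergy hS hS0,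
    Finset.sum_add_distrib, ← Finset.mul_sum, Finset.sum_comm, expect_const_mul,
    sum_expect_sqrt_smul (fun k x => (hpos (x k)).le) fun k => hpiece (hwk k).continuous,
    expect_sum fun j =>
      integrable_mul_norm_sq (continuous_deriv_sq_div hw hpos j) hΨ.continuous hΨc,
    add_right_comm, ← mul_add, ← Finset.sum_add_distrib]
  gcongr with j
  exact sum_kinetic_sqrt_comp_eval_smul_le hw hpos hΨ hΨc j

end Localization

section Criterion

variable {ι : Type} [Fintype ι] [LinearOrder ι] {M Z e : ℝ} {Vt : ι → ℝ → ℝ}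
  {Wt : ι → ι → ℝ → ℝ} {w g : ℝ → ℝ}

variable (M Z Vt Wt g) in
/-- The potential of the particle `k` with its kinetic energy replaced by the lower bound
`(1/M) (g' - g²)` that the function `g` provides through the Riccati inequality. -/
def riccatiPotential (k : ι) (x : ι → ℝ) : ℝ :=
  (1 / M) * (deriv g (x k) - g (x k) ^ 2) + particlePotential Z Vt Wt k x

lemma integrable_deriv_sub_sq_mul_norm_sq (hg : ContDiff ℝ 1 g) (k : ι) {ψ : (ι → ℝ) → ℂ}
    (hψ : Continuous ψ) (hψc : HasCompactSupport ψ) :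
    Integrable fun x => (1 / M) * (deriv g (x k) - g (x k) ^ 2) * ‖ψ x‖ ^ 2 :=
  integrable_mul_norm_sq (continuous_const.mul (((hg.continuous_deriv le_rfl).sub
    (hg.continuous.pow 2)).comp (continuous_apply k))) hψ hψc

lemma integrable_riccatiPotential_mul_norm_sq (hg : ContDiff ℝ 1 g)
    (hV : ∀ j, LocallyIntegrable (Vt j)) (hWm : ∀ j l, j < l → Measurable (Wt j l))
    (hW : ∀ j l, j < l → ∀ t, t ≠ 0 → 0 ≤ Wt j l t) (k : ι) {ψ : (ι → ℝ) → ℂ}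
    (hψ : Continuous ψ) (hψc : HasCompactSupport ψ)
    (hint : Integrable fun x => potential Z Vt Wt x * ‖ψ x‖ ^ 2) :
    Integrable fun x => riccatiPotential M Z Vt Wt g k x * ‖ψ x‖ ^ 2 := by
  simpa only [riccatiPotential, add_mul] using
    (integrable_deriv_sub_sq_mul_norm_sq hg k hψ hψc).fun_add
      (integrable_particlePotential_mul_norm_sq hV hWm hW hψ hψc hint k)

lemma add_expect_riccatiPotential_le_energy (hM : 0 < M) (hg : ContDiff ℝ 1 g)
    (hV : ∀ j, LocallyIntegrable (Vt j)) (hWm : ∀ j l, j < l → Measurable (Wt j l))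
    (hW : ∀ j l, j < l → ∀ t, t ≠ 0 → 0 ≤ Wt j l t) {k : ι}
    (he : (e : EReal) ≤ groundEnergyWithout M Z Vt Wt k) {ψ : (ι → ℝ) → ℂ} (hψ : ContDiff ℝ ∞ ψ)
    (hψc : HasCompactSupport ψ) (hint : Integrable fun x => potential Z Vt Wt x * ‖ψ x‖ ^ 2) :
    e * (∫ x, ‖ψ x‖ ^ 2) + expect (riccatiPotential M Z Vt Wt g k) ψ ≤ energy M Z Vt Wt ψ := by
  have hψ1 : ContDiff ℝ 1 ψ := hψ.of_le (mod_cast le_top)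
  have hparticle := integrable_particlePotential_mul_norm_sq hV hWm hW hψ.continuous hψc hint k
  have hwithout : Integrable fun x => potentialWithout Z Vt Wt k x * ‖ψ x‖ ^ 2 := by
    refine (hint.sub hparticle).congr (.of_forall fun x => ?_)
    simp only [Pi.sub_apply, potential_eq_potentialWithout_add_particlePotential Z Vt Wt k]
    ring
  have hpotential : expect (potential Z Vt Wt) ψ =
      expect (potentialWithout Z Vt Wt k) ψ + expect (particlePotential Z Vt Wt k) ψ := by
    rw [← expect_add hwithout hparticle]
    simp only [← potential_eq_potentialWithout_add_particlePotential]
  have hkinetic : expect (fun x => deriv g (x k) - g (x k) ^ 2) ψ ≤ kinetic (Pi.single k 1) ψ := by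
    simpa [fderiv_comp_eval_single (hg.differentiable one_ne_zero _)] using
      expect_fderiv_sub_sq_le_kinetic (contDiff_comp_eval hg k) hψ1 hψc (Pi.single k 1)
  have hriccati : expect (riccatiPotential M Z Vt Wt g k) ψ =
      (1 / M) * expect (fun x => deriv g (x k) - g (x k) ^ 2) ψ
        + expect (particlePotential Z Vt Wt k) ψ := by
    rw [← expect_const_mul, ← expect_add
      (integrable_deriv_sub_sq_mul_norm_sq hg k hψ.continuous hψc) hparticle]
    rfl
  have hslice := mul_integral_norm_sq_le_of_le_groundEnergyWithout he hψ hψc hwithout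
  have hscaled := mul_le_mul_of_nonneg_left hkinetic (one_div_nonneg.2 hM.le)
  rw [energy_eq_kinetic_add_expect hψ1 hψc hint, Fintype.sum_eq_add_sum_subtype_ne _ k, hpotential,
    hriccati]
  linarith

variable [Nonempty ι]

lemma mul_integral_norm_sq_le_energy_of_riccatiPotential (hM : 0 < M) (hw : ContDiff ℝ ∞ w)
    (hpos : ∀ s, 0 < w s) (hg : ContDiff ℝ 1 g) (hV : ∀ j, LocallyIntegrable (Vt j))
    (hWm : ∀ j l, j < l → Measurable (Wt j l)) (hW : ∀ j l, j < l → ∀ t, t ≠ 0 → 0 ≤ Wt j l t)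
    (hlocal : ∀ᵐ x : ι → ℝ, (1 / M) * ∑ j, deriv w (x j) ^ 2 / (4 * w (x j)) ≤
      ∑ k, w (x k) * riccatiPotential M Z Vt Wt g k x)
    (he : ∀ k, (e : EReal) ≤ groundEnergyWithout M Z Vt Wt k) {Ψ : (ι → ℝ) → ℂ}
    (hΨ : ContDiff ℝ ∞ Ψ) (hΨc : HasCompactSupport Ψ)
    (hint : Integrable fun x => potential Z Vt Wt x * ‖Ψ x‖ ^ 2) :
    e * ∫ x, ‖√(∑ k, w (x k)) • Ψ x‖ ^ 2 ≤
      energy M Z Vt Wt (fun x => √(∑ k, w (x k)) • Ψ x) := by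
  have hw1 : ContDiff ℝ 1 w := hw.of_le (mod_cast le_top)
  have hψ : ∀ k, ContDiff ℝ ∞ fun x => √(w (x k)) • Ψ x :=
    fun k => contDiff_sqrt_smul (contDiff_comp_eval hw k) (fun x => hpos (x k)) hΨ
  have hψc : ∀ k, HasCompactSupport fun x => √(w (x k)) • Ψ x :=
    fun k => hΨc.smul_left (f := fun x : ι → ℝ => √(w (x k)))
  have hψint : ∀ k, Integrable fun x => potential Z Vt Wt x * ‖√(w (x k)) • Ψ x‖ ^ 2 :=
    fun k => integrable_mul_norm_smul_sq hint (contDiff_comp_eval hw k).continuous.sqrt hΨc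
  have hnorm : ∑ k, expect (fun _ => e) (fun x => √(w (x k)) • Ψ x) =
      expect (fun _ => e) (fun x => √(∑ k, w (x k)) • Ψ x) :=
    sum_expect_sqrt_smul (fun k x => (hpos (x k)).le) fun k =>
      integrable_mul_norm_sq continuous_const (hψ k).continuous (hψc k)
  have herror : expect (fun x => (1 / M) * ∑ j, deriv w (x j) ^ 2 / (4 * w (x j))) Ψ ≤
      ∑ k, expect (riccatiPotential M Z Vt Wt g k) fun x => √(w (x k)) • Ψ x :=
    expect_le_sum_expect_sqrt_smul (fun k x => (hpos (x k)).le)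
      (integrable_mul_norm_sq (continuous_const.mul
        (continuous_finsetSum _ fun j _ => continuous_deriv_sq_div hw1 hpos j)) hΨ.continuous hΨc)
      (fun k => integrable_riccatiPotential_mul_norm_sq hg hV hWm hW k (hψ k).continuous (hψc k)
        (hψint k)) hlocal
  have hlower := Finset.sum_le_sum fun k (_ : k ∈ Finset.univ) =>
    add_expect_riccatiPotential_le_energy hM hg hV hWm hW (he k) (hψ k) (hψc k) (hψint k)
  have hupper := sum_energy_sqrt_comp_eval_smul_le (Z := Z) (Vt := Vt) (Wt := Wt) hM hw1 hpos
    (hΨ.of_le (mod_cast le_top)) hΨc hint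
  rw [Finset.sum_add_distrib] at hlower
  simp only [expect, integral_const_mul] at hnorm
  linarith

theorem not_hasBoundState_of_riccatiPotential (hM : 0 < M) (hw : ContDiff ℝ ∞ w)
    (hpos : ∀ s, 0 < w s) (hg : ContDiff ℝ 1 g) (hV : ∀ j, LocallyIntegrable (Vt j))
    (hWm : ∀ j l, j < l → Measurable (Wt j l)) (hW : ∀ j l, j < l → ∀ t, t ≠ 0 → 0 ≤ Wt j l t)
    (hlocal : ∀ᵐ x : ι → ℝ, (1 / M) * ∑ j, deriv w (x j) ^ 2 / (4 * w (x j)) ≤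
      ∑ k, w (x k) * riccatiPotential M Z Vt Wt g k x) : ¬HasBoundState M Z Vt Wt := by
  intro hbound
  obtain ⟨k₀, hk₀⟩ := Finite.exists_min (groundEnergyWithout M Z Vt Wt)
  obtain ⟨e, hgt, hlt⟩ := EReal.lt_iff_exists_real_btwn.1 (hbound k₀)
  refine hgt.not_ge (le_iInf₂ fun Φ hΦ => EReal.coe_le_coe_iff.2 ?_)
  have hsum : ∀ x : ι → ℝ, 0 < ∑ k, w (x k) :=
    fun x => Finset.sum_pos (fun k _ => hpos _) Finset.univ_nonempty
  have hroot : ContDiff ℝ ∞ fun x : ι → ℝ => (√(∑ k, w (x k)))⁻¹ :=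
    ((ContDiff.sum fun k _ => contDiff_comp_eval hw k).sqrt fun x => (hsum x).ne').inv
      fun x => (Real.sqrt_pos.2 (hsum x)).ne'
  have hle := mul_integral_norm_sq_le_energy_of_riccatiPotential
    (Ψ := fun x => (√(∑ k, w (x k)))⁻¹ • Φ x) hM hw hpos hg hV hWm hW hlocal
    (fun k => hlt.le.trans (hk₀ k)) (hroot.smul hΦ.contDiff)
    (hΦ.hasCompactSupport.smul_left (f := fun x : ι → ℝ => (√(∑ k, w (x k)))⁻¹))
    (integrable_mul_norm_smul_sq hΦ.integrable hroot.continuous hΦ.hasCompactSupport)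
  simpa only [smul_inv_smul₀ (Real.sqrt_pos.2 (hsum _)).ne', hΦ.norm_eq_one, mul_one] using hle

end Criterion

section SpecialFunctions

lemma integrableOn_pow_mul_exp_neg_sq (n : ℕ) :
    IntegrableOn (fun s : ℝ => s ^ n * Real.exp (-s ^ 2)) (Set.Ioi 0) := by
  refine (integrableOn_rpow_mul_exp_neg_rpow (p := 2) (s := (n : ℝ))
    (neg_one_lt_zero.trans_le n.cast_nonneg) two_pos).congr_fun (fun s _ => ?_) measurableSet_Ioi
  simp [Real.rpow_natCast]

lemma integral_pow_mul_exp_neg_sq (n : ℕ) :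
    ∫ s in Set.Ioi (0 : ℝ), s ^ n * Real.exp (-s ^ 2) = Real.Gamma ((n + 1) / 2) / 2 := by
  rw [div_eq_inv_mul _ (2 : ℝ), ← one_div, ← integral_rpow_mul_exp_neg_rpow (p := 2) (q := (n : ℝ))
    two_pos (neg_one_lt_zero.trans_le n.cast_nonneg)]
  simp [Real.rpow_natCast]

lemma integral_odd_pow_mul_exp_neg_sq (m : ℕ) :
    ∫ s in Set.Ioi (0 : ℝ), s ^ (2 * m + 1) * Real.exp (-s ^ 2) = m.factorial / 2 := by
  rw [integral_pow_mul_exp_neg_sq, ← Real.Gamma_nat_eq_factorial]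
  congr 2
  push_cast
  ring

lemma Gamma_nat_add_half_le (m : ℕ) : Real.Gamma (m + 1 / 2) ≤ 2 * m.factorial := by
  induction m with
  | zero =>
    simp only [Nat.cast_zero, zero_add, Real.Gamma_one_half_eq, Nat.factorial_zero, Nat.cast_one,
      mul_one]
    rw [Real.sqrt_le_left two_pos.le]
    linarith [Real.pi_lt_four]
  | succ m ih =>
    have hstep : ((m + 1 : ℕ) : ℝ) + 1 / 2 = (m + 1 / 2) + 1 := by push_cast; ring
    rw [hstep, Real.Gamma_add_one (by positivity), Nat.factorial_succ]
    calc ((m : ℝ) + 1 / 2) * Real.Gamma (m + 1 / 2) ≤ (m + 1) * (2 * m.factorial) := by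
          gcongr
          norm_num
      _ = 2 * ((m + 1) * m.factorial : ℕ) := by push_cast; ring

lemma integral_even_pow_mul_exp_neg_sq_le (m : ℕ) :
    ∫ s in Set.Ioi (0 : ℝ), s ^ (2 * m) * Real.exp (-s ^ 2) ≤ m.factorial := by
  have hhalf : (((2 * m : ℕ) : ℝ) + 1) / 2 = m + 1 / 2 := by push_cast; ring
  rw [integral_pow_mul_exp_neg_sq, hhalf]
  linarith [Gamma_nat_add_half_le m]

lemma integrableOn_V_integrand (m : ℕ) (x : ℝ) :
    IntegrableOn (fun s : ℝ => s ^ (2 * m) * Real.exp (-s ^ 2) / √(x ^ 2 + s ^ 2) * s)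
      (Set.Ioi 0) := by
  refine (integrableOn_pow_mul_exp_neg_sq (2 * m)).mono'
    (by fun_prop : Measurable _).aestronglyMeasurable
    ((ae_restrict_mem measurableSet_Ioi).mono fun s (hs : 0 < s) => ?_)
  have hle : s ≤ √(x ^ 2 + s ^ 2) := Real.le_sqrt_of_sq_le (le_add_of_nonneg_left (sq_nonneg x))
  rw [Real.norm_of_nonneg (by positivity), div_mul_eq_mul_div, div_le_iff₀ (hs.trans_le hle)]
  gcongr

lemma mul_sqrt_one_add_sq_le {s : ℝ} (hs : 0 ≤ s) (x : ℝ) :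
    s * √(1 + x ^ 2) ≤ (s + 1) * √(x ^ 2 + s ^ 2) := by
  refine abs_le_of_sq_le_sq' ?_ (by positivity) |>.2
  rw [mul_pow, mul_pow, Real.sq_sqrt (by positivity), Real.sq_sqrt (by positivity)]
  have : 0 ≤ s * x ^ 2 * 2 + x ^ 2 + s ^ 4 + 2 * s ^ 3 := by positivity
  linarith

lemma V_le (m : ℕ) (x : ℝ) : V m x ≤ 2 / √(1 + x ^ 2) := by
  have hodd := integrableOn_pow_mul_exp_neg_sq (2 * m + 1)
  have heven := integrableOn_pow_mul_exp_neg_sq (2 * m)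
  have hx : 0 < √(1 + x ^ 2) := Real.sqrt_pos.2 (by positivity)
  have hintegrand : ∀ s ∈ Set.Ioi (0 : ℝ),
      s ^ (2 * m) * Real.exp (-s ^ 2) / √(x ^ 2 + s ^ 2) * s ≤
        (s ^ (2 * m + 1) * Real.exp (-s ^ 2) + s ^ (2 * m) * Real.exp (-s ^ 2)) / √(1 + x ^ 2) := by
    intro s (hs : 0 < s)
    calc s ^ (2 * m) * Real.exp (-s ^ 2) / √(x ^ 2 + s ^ 2) * s
        = s ^ (2 * m) * Real.exp (-s ^ 2) * (s / √(x ^ 2 + s ^ 2)) := by ring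
      _ ≤ s ^ (2 * m) * Real.exp (-s ^ 2) * ((s + 1) / √(1 + x ^ 2)) := by
          gcongr ?_ * ?_
          exact (div_le_div_iff₀ (Real.sqrt_pos.2 (by positivity)) hx).2
            (mul_sqrt_one_add_sq_le hs.le x)
      _ = _ := by ring
  calc V m x ≤ 1 / m.factorial * ∫ s in Set.Ioi (0 : ℝ),
        (s ^ (2 * m + 1) * Real.exp (-s ^ 2) + s ^ (2 * m) * Real.exp (-s ^ 2)) / √(1 + x ^ 2) :=
        mul_le_mul_of_nonneg_left (setIntegral_mono_on (integrableOn_V_integrand m x)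
          ((hodd.add heven).div_const _) measurableSet_Ioi hintegrand) (by positivity)
    _ = 1 / m.factorial * ((m.factorial / 2
          + ∫ s in Set.Ioi (0 : ℝ), s ^ (2 * m) * Real.exp (-s ^ 2)) / √(1 + x ^ 2)) := by
        rw [integral_div, integral_add hodd heven, integral_odd_pow_mul_exp_neg_sq]
    _ ≤ 1 / m.factorial * ((m.factorial / 2 + m.factorial) / √(1 + x ^ 2)) := by
        gcongr
        exact integral_even_pow_mul_exp_neg_sq_le m
    _ = 3 / 2 / √(1 + x ^ 2) := by
        have : (m.factorial : ℝ) ≠ 0 := Nat.cast_ne_zero.2 m.factorial_ne_zero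
        field_simp
        ring
    _ ≤ 2 / √(1 + x ^ 2) := by gcongr; norm_num

/-- The tangent line at `T` of the convex function `t ↦ 1 / √t`. -/
lemma tangent_le_one_div_sqrt {t T : ℝ} (ht : 0 < t) (hT : 0 < T) :
    (3 * T - t) / (2 * T * √T) ≤ 1 / √t := by
  obtain ⟨a, ha, hta⟩ : ∃ a, 0 < a ∧ √t = a := ⟨_, Real.sqrt_pos.2 ht, rfl⟩
  obtain ⟨c, hc, hTc⟩ : ∃ c, 0 < c ∧ √T = c := ⟨_, Real.sqrt_pos.2 hT, rfl⟩
  rw [hta, hTc, div_le_div_iff₀ (by positivity) ha, (Real.sqrt_eq_iff_eq_sq ht.le ha.le).1 hta,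
    (Real.sqrt_eq_iff_eq_sq hT.le hc.le).1 hTc]
  linarith [mul_nonneg (by positivity : 0 ≤ a + 2 * c) (sq_nonneg (a - c))]

/-- Jensen's inequality: `s²` has mean `m + 1` under the probability density
`2 s^(2m+1) e^(-s²) / m!`. -/
lemma le_V (m : ℕ) (y : ℝ) : 1 / (2 * √(y ^ 2 + (m + 1))) ≤ V m y := by
  set T : ℝ := y ^ 2 + (m + 1) with hTdef
  have hT : 0 < T := by positivity
  have hodd := (integrableOn_pow_mul_exp_neg_sq (2 * m + 1)).const_mul (3 * T - y ^ 2)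
  have hodd' := integrableOn_pow_mul_exp_neg_sq (2 * (m + 1) + 1)
  have hintegrand : ∀ s ∈ Set.Ioi (0 : ℝ), ((3 * T - y ^ 2) * (s ^ (2 * m + 1) * Real.exp (-s ^ 2))
      - s ^ (2 * (m + 1) + 1) * Real.exp (-s ^ 2)) / (2 * T * √T) ≤
        s ^ (2 * m) * Real.exp (-s ^ 2) / √(y ^ 2 + s ^ 2) * s := by
    intro s (hs : 0 < s)
    calc _ = s ^ (2 * m + 1) * Real.exp (-s ^ 2) *
          ((3 * T - (y ^ 2 + s ^ 2)) / (2 * T * √T)) := by ring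
      _ ≤ s ^ (2 * m + 1) * Real.exp (-s ^ 2) * (1 / √(y ^ 2 + s ^ 2)) := by
          gcongr ?_ * ?_
          exact tangent_le_one_div_sqrt (by positivity) hT
      _ = _ := by ring
  calc 1 / (2 * √T) = 1 / m.factorial * (((3 * T - y ^ 2) * (m.factorial / 2)
        - (m + 1).factorial / 2) / (2 * T * √T)) := by
        have : √T ≠ 0 := (Real.sqrt_pos.2 hT).ne'
        have : (m.factorial : ℝ) ≠ 0 := Nat.cast_ne_zero.2 m.factorial_ne_zero
        rw [show 3 * T - y ^ 2 = 2 * T + (m + 1) by rw [hTdef]; ring, Nat.factorial_succ]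
        push_cast
        field_simp
        ring
    _ = 1 / m.factorial * ∫ s in Set.Ioi (0 : ℝ),
          ((3 * T - y ^ 2) * (s ^ (2 * m + 1) * Real.exp (-s ^ 2))
            - s ^ (2 * (m + 1) + 1) * Real.exp (-s ^ 2)) / (2 * T * √T) := by
        rw [integral_div, integral_sub hodd hodd', integral_const_mul,
          integral_odd_pow_mul_exp_neg_sq, integral_odd_pow_mul_exp_neg_sq]
    _ ≤ V m y := mul_le_mul_of_nonneg_left (setIntegral_mono_on ((hodd.sub hodd').div_const _)
        (integrableOn_V_integrand m y) measurableSet_Ioi hintegrand) (by positivity)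

lemma le_VPred (n : ℕ) {x : ℝ} (hx : x ≠ 0) :
    1 / (2 * √(x ^ 2 + 2 * n)) ≤ (1 / √2) * VPred n (x / √2) := by
  cases n with
  | zero =>
    have hx' : 0 < |x| := abs_pos.2 hx
    calc 1 / (2 * √(x ^ 2 + 2 * (0 : ℕ))) = 1 / (2 * |x|) := by
          rw [Nat.cast_zero, mul_zero, add_zero, Real.sqrt_sq_eq_abs]
      _ ≤ 1 / |x| := one_div_le_one_div_of_le hx' (by linarith)
      _ = (1 / √2) * VPred 0 (x / √2) := by
          rw [VPred, abs_div, abs_of_nonneg (Real.sqrt_nonneg 2)]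
          field_simp
  | succ m =>
    have hscale : x ^ 2 + 2 * ((m + 1 : ℕ) : ℝ) = 2 * ((x / √2) ^ 2 + (m + 1)) := by
      rw [div_pow, Real.sq_sqrt two_pos.le]
      push_cast
      ring
    calc 1 / (2 * √(x ^ 2 + 2 * ((m + 1 : ℕ) : ℝ)))
        = (1 / √2) * (1 / (2 * √((x / √2) ^ 2 + (m + 1)))) := by
          rw [hscale, Real.sqrt_mul two_pos.le]
          field_simp
      _ ≤ (1 / √2) * VPred (m + 1) (x / √2) := by
          gcongr
          exact le_V m _

end SpecialFunctions

section Weight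

/-- The one-particle localization weight at length scale `R`, a smooth version of `max R |x|`. -/
def weight (R x : ℝ) : ℝ := √(R ^ 2 + x ^ 2)

variable {R : ℝ}

lemma weight_sq (R x : ℝ) : weight R x ^ 2 = R ^ 2 + x ^ 2 := Real.sq_sqrt (by positivity)

lemma weight_pos (hR : 0 < R) (x : ℝ) : 0 < weight R x := Real.sqrt_pos.2 (by positivity)

lemma le_weight (R x : ℝ) : R ≤ weight R x :=
  Real.le_sqrt_of_sq_le (le_add_of_nonneg_right (sq_nonneg x))

lemma abs_le_weight (R x : ℝ) : |x| ≤ weight R x :=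
  Real.abs_le_sqrt (le_add_of_nonneg_left (sq_nonneg R))

lemma contDiff_weight (hR : 0 < R) {n : WithTop ℕ∞} : ContDiff ℝ n (weight R) :=
  (contDiff_const.add (contDiff_id.pow 2)).sqrt
    (fun x => (by positivity : 0 < R ^ 2 + x ^ 2).ne')

lemma hasDerivAt_sq_add_sq (R x : ℝ) : HasDerivAt (fun x : ℝ => R ^ 2 + x ^ 2) (2 * x) x := by
  simpa using (hasDerivAt_pow 2 x).const_add (R ^ 2)

lemma hasDerivAt_weight (hR : 0 < R) (x : ℝ) : HasDerivAt (weight R) (x / weight R x) x :=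
  ((hasDerivAt_sq_add_sq R x).sqrt (by positivity)).congr_deriv (mul_div_mul_left _ _ two_ne_zero)

lemma deriv_weight_sq_div_le (hR : 0 < R) (x : ℝ) :
    deriv (weight R) x ^ 2 / (4 * weight R x) ≤ 1 / (4 * R) := by
  have hw := weight_pos hR x
  have hderiv : deriv (weight R) x ^ 2 ≤ 1 := by
    rw [(hasDerivAt_weight hR x).deriv, div_pow, div_le_one (by positivity), weight_sq]
    exact le_add_of_nonneg_left (sq_nonneg R)
  gcongr
  exact le_weight R x

lemma sqrt_sub_sq_add_le_weight_add_weight {t : ℝ} (htR : t ≤ 4 * R ^ 2) (hR : 0 < R) (x y : ℝ) :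
    √((x - y) ^ 2 + t) ≤ weight R x + weight R y := by
  have hx := weight_pos hR x
  have hy := weight_pos hR y
  have hprod : R ^ 2 + |x| * |y| ≤ weight R x * weight R y := by
    refine abs_le_of_sq_le_sq' ?_ (by positivity) |>.2
    rw [mul_pow, weight_sq, weight_sq]
    nlinarith [sq_nonneg (R * (|x| - |y|)), sq_abs x, sq_abs y]
  have hxy : -(x * y) ≤ |x| * |y| := (neg_le_abs _).trans_eq (abs_mul x y)
  rw [Real.sqrt_le_left (by positivity)]
  nlinarith [weight_sq R x, weight_sq R y]

lemma half_le_weight_add_weight_mul {t W : ℝ} (ht : 0 ≤ t) (htR : t ≤ 4 * R ^ 2) (hR : 0 < R)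
    {x y : ℝ} (hxy : x - y ≠ 0) (hW : 1 / (2 * √((x - y) ^ 2 + t)) ≤ W) :
    1 / 2 ≤ (weight R x + weight R y) * W := by
  have : 0 < √((x - y) ^ 2 + t) := Real.sqrt_pos.2 (by positivity)
  calc 1 / 2 = √((x - y) ^ 2 + t) * (1 / (2 * √((x - y) ^ 2 + t))) := by field_simp
    _ ≤ (weight R x + weight R y) * W :=
      mul_le_mul (sqrt_sub_sq_add_le_weight_add_weight htR hR x y) hW (by positivity)
        (add_pos (weight_pos hR x) (weight_pos hR y)).le

end Weight

section Damping

/-- A bounded function that behaves like the primitive `arsinh` of `1 / √(1 + x²)` for `|x| ≪ R`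
and tends to `0` for `|x| ≫ R`. -/
def damp (R x : ℝ) : ℝ := Real.arsinh x * (R ^ 2 / (R ^ 2 + x ^ 2))

variable {R : ℝ}

lemma hasDerivAt_damp (hR : 0 < R) (x : ℝ) :
    HasDerivAt (damp R) ((√(1 + x ^ 2))⁻¹ * (R ^ 2 / (R ^ 2 + x ^ 2))
      + Real.arsinh x * (-(R ^ 2 * (2 * x)) / (R ^ 2 + x ^ 2) ^ 2)) x :=
  ((Real.hasDerivAt_arsinh x).mul ((hasDerivAt_const x (R ^ 2)).div (hasDerivAt_sq_add_sq R x)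
    (by positivity))).congr_deriv (by simp)

lemma contDiff_damp (hR : 0 < R) {n : WithTop ℕ∞} : ContDiff ℝ n (damp R) :=
  Real.contDiff_arsinh.mul (contDiff_const.div (contDiff_const.add (contDiff_id.pow 2))
    (fun x => (by positivity : 0 < R ^ 2 + x ^ 2).ne'))

lemma one_le_log_two_mul_add_one (hR : 1 ≤ R) : 1 ≤ Real.log (2 * R + 1) := by
  rw [Real.le_log_iff_exp_le (by positivity)]
  linarith [Real.exp_one_lt_d9]

lemma abs_arsinh (x : ℝ) : |Real.arsinh x| = Real.arsinh |x| := by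
  rcases le_total 0 x with h | h
  · rw [abs_of_nonneg h, abs_of_nonneg (Real.arsinh_nonneg_iff.2 h)]
  · rw [abs_of_nonpos h, abs_of_nonpos (Real.arsinh_nonpos_iff.2 h), Real.arsinh_neg]

lemma abs_arsinh_le (hR : 1 ≤ R) (x : ℝ) :
    |Real.arsinh x| ≤ Real.log (2 * R + 1) * (weight R x / R) := by
  have hR0 : 0 < R := one_pos.trans_le hR
  have hw := weight_pos hR0 x
  have hratio : 1 ≤ weight R x / R := (one_le_div hR0).2 (le_weight R x)
  have hsqrt : √(1 + |x| ^ 2) ≤ 1 + |x| := by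
    rw [Real.sqrt_le_left (by positivity)]
    linarith [abs_nonneg x]
  have hexp : |x| + √(1 + |x| ^ 2) ≤ (2 * R + 1) * (weight R x / R) :=
    calc |x| + √(1 + |x| ^ 2) ≤ 2 * weight R x + weight R x / R := by
          linarith [abs_le_weight R x]
      _ = (2 * R + 1) * (weight R x / R) := by field_simp
  calc |Real.arsinh x| = Real.log (|x| + √(1 + |x| ^ 2)) := abs_arsinh x
    _ ≤ Real.log ((2 * R + 1) * (weight R x / R)) := Real.log_le_log (by positivity) hexp
    _ = Real.log (2 * R + 1) + Real.log (weight R x / R) :=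
        Real.log_mul (by positivity) (by positivity)
    _ ≤ Real.log (2 * R + 1) + 1 * (weight R x / R - 1) := by
        rw [one_mul]
        gcongr
        exact Real.log_le_sub_one_of_pos (by positivity)
    _ ≤ Real.log (2 * R + 1) + Real.log (2 * R + 1) * (weight R x / R - 1) := by
        gcongr
        exact one_le_log_two_mul_add_one hR
    _ = Real.log (2 * R + 1) * (weight R x / R) := by ring

lemma weight_mul_sub_deriv_damp (hR : 0 < R) (x : ℝ) :
    weight R x * (1 / √(1 + x ^ 2) - deriv (damp R) x) =
      x ^ 2 / (weight R x * √(1 + x ^ 2))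
        + 2 * R ^ 2 * (x * Real.arsinh x) / weight R x ^ 3 := by
  have hw := weight_pos hR x
  have : 0 < √(1 + x ^ 2) := Real.sqrt_pos.2 (by positivity)
  have hratio : R ^ 2 / weight R x ^ 2 = 1 - x ^ 2 / weight R x ^ 2 := by
    rw [eq_sub_iff_add_eq, ← add_div, ← weight_sq, div_self (by positivity)]
  rw [(hasDerivAt_damp hR x).deriv, ← weight_sq, hratio]
  field_simp
  ring

lemma weight_mul_sub_deriv_damp_le (hR : 1 ≤ R) (x : ℝ) :
    weight R x * (1 / √(1 + x ^ 2) - deriv (damp R) x) ≤ 2 * Real.log (2 * R + 1) := by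
  have hR0 : 0 < R := one_pos.trans_le hR
  have hw := weight_pos hR0 x
  have hl := one_le_log_two_mul_add_one hR
  have : 0 < √(1 + x ^ 2) := Real.sqrt_pos.2 (by positivity)
  have hfar : x ^ 2 / (weight R x * √(1 + x ^ 2)) ≤ 1 := by
    rw [div_le_one (by positivity)]
    calc x ^ 2 = |x| * |x| := by rw [abs_mul_abs_self, sq]
      _ ≤ weight R x * √(1 + x ^ 2) :=
        mul_le_mul (abs_le_weight R x) (Real.abs_le_sqrt (by linarith)) (abs_nonneg _) hw.le
  have hcutoff : 2 * R ^ 2 * (x * Real.arsinh x) / weight R x ^ 3 ≤ Real.log (2 * R + 1) := by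
    rw [div_le_iff₀ (by positivity)]
    calc 2 * R ^ 2 * (x * Real.arsinh x) ≤ 2 * R ^ 2 * (|x| * |Real.arsinh x|) := by
          rw [← abs_mul]
          gcongr
          exact le_abs_self _
      _ ≤ 2 * R ^ 2 * (|x| * (Real.log (2 * R + 1) * (weight R x / R))) := by
          gcongr
          exact abs_arsinh_le hR x
      _ = Real.log (2 * R + 1) * weight R x * (2 * R * |x|) := by field_simp
      _ ≤ Real.log (2 * R + 1) * weight R x * weight R x ^ 2 := by
          gcongr
          rw [weight_sq, ← sq_abs x]
          exact two_mul_le_add_sq R |x|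
      _ = Real.log (2 * R + 1) * weight R x ^ 3 := by ring
  rw [weight_mul_sub_deriv_damp hR0]
  linarith

lemma weight_mul_damp_sq_le (hR : 1 ≤ R) (x : ℝ) :
    weight R x * damp R x ^ 2 ≤ Real.log (2 * R + 1) ^ 2 * R := by
  have hR0 : 0 < R := one_pos.trans_le hR
  have hw := weight_pos hR0 x
  have hl := one_le_log_two_mul_add_one hR
  calc weight R x * damp R x ^ 2
      = |Real.arsinh x| ^ 2 * (R ^ 4 / weight R x ^ 3) := by
        rw [damp, ← weight_sq, sq_abs]
        field_simp
    _ ≤ (Real.log (2 * R + 1) * (weight R x / R)) ^ 2 * (R ^ 4 / weight R x ^ 3) := by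
        gcongr
        exact abs_arsinh_le hR x
    _ = Real.log (2 * R + 1) ^ 2 * R * (R / weight R x) := by field_simp
    _ ≤ Real.log (2 * R + 1) ^ 2 * R :=
        mul_le_of_le_one_right (by positivity) ((div_le_one hw).2 (le_weight R x))

/-- With `g = 2 Z M damp R`, the term `g' / M` cancels the attraction `2 Z / √(1 + x²)` near `0`. -/
lemma weight_mul_attraction_le {M Z v : ℝ} (hM : 0 < M) (hZ : 0 ≤ Z) (hR : 1 ≤ R) {x : ℝ}
    (hv : v ≤ 2 / √(1 + x ^ 2)) :
    weight R x * (Z * v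
      - (1 / M) * (deriv (fun y => 2 * Z * M * damp R y) x - (2 * Z * M * damp R x) ^ 2)) ≤
      4 * Z * Real.log (2 * R + 1) + 4 * Z ^ 2 * Real.log (2 * R + 1) ^ 2 * R * M := by
  have hR0 : 0 < R := one_pos.trans_le hR
  rw [deriv_const_mul _ (hasDerivAt_damp hR0 x).differentiableAt]
  calc _ ≤ weight R x * (Z * (2 / √(1 + x ^ 2))
        - (1 / M) * (2 * Z * M * deriv (damp R) x - (2 * Z * M * damp R x) ^ 2)) := by
        gcongr
        exact (weight_pos hR0 x).le
    _ = 2 * Z * (weight R x * (1 / √(1 + x ^ 2) - deriv (damp R) x))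
        + 4 * Z ^ 2 * M * (weight R x * damp R x ^ 2) := by field_simp; ring
    _ ≤ 2 * Z * (2 * Real.log (2 * R + 1)) + 4 * Z ^ 2 * M * (Real.log (2 * R + 1) ^ 2 * R) := by
        gcongr ?_ * ?_ + ?_ * ?_
        · exact weight_mul_sub_deriv_damp_le hR x
        · exact weight_mul_damp_sq_le hR x
    _ = _ := by ring

end Damping

section ManyParticles

lemma sum_mul_sum_eq_of_symm {κ : Type*} [Fintype κ] {f : κ → κ → ℝ} (hf : ∀ j k, f j k = f k j)
    (w : κ → ℝ) : ∑ k, w k * ∑ j, f k j = ∑ k, ∑ j, (w k + w j) * f k j / 2 := by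
  have hswap : ∑ k, ∑ j, w j * f k j = ∑ k, ∑ j, w k * f k j := by
    rw [Finset.sum_comm]
    simp only [hf]
  simp only [← Finset.sum_div, add_mul, Finset.sum_add_distrib, hswap, Finset.mul_sum]
  ring

lemma half_le_weight_add_weight_mul_pairPotential {ι : Type} [LinearOrder ι] {R t : ℝ}
    {Wt : ι → ι → ℝ → ℝ} (ht : 0 ≤ t) (htR : t ≤ 4 * R ^ 2) (hR : 0 < R)
    (hW : ∀ j l, j < l → ∀ s, s ≠ 0 → 1 / (2 * √(s ^ 2 + t)) ≤ Wt j l s)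
    {x : ι → ℝ} {j k : ι} (hjk : j ≠ k) (hx : ∀ j l, j ≠ l → x j - x l ≠ 0) :
    1 / 2 ≤ (weight R (x k) + weight R (x j))
      * (pairPotential Wt k j x + pairPotential Wt j k x) := by
  rcases hjk.lt_or_gt with h | h
  · have hne := hx j k hjk
    simpa [pairPotential, h, h.not_gt, add_comm] using
      half_le_weight_add_weight_mul ht htR hR hne (hW j k h _ hne)
  · have hne := hx k j hjk.symm
    simpa [pairPotential, h, h.not_gt] using
      half_le_weight_add_weight_mul ht htR hR hne (hW k j h _ hne)

variable {ι : Type} [Fintype ι] [LinearOrder ι] {R M Z t : ℝ} {Vt : ι → ℝ → ℝ}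
  {Wt : ι → ι → ℝ → ℝ}

lemma le_sum_weight_mul_pairPotential (ht : 0 ≤ t) (htR : t ≤ 4 * R ^ 2) (hR : 0 < R)
    (hW : ∀ j l, j < l → ∀ s, s ≠ 0 → 1 / (2 * √(s ^ 2 + t)) ≤ Wt j l s)
    {x : ι → ℝ} (hx : ∀ j l, j ≠ l → x j - x l ≠ 0) :
    (Fintype.card ι : ℝ) * (Fintype.card ι - 1) / 4 ≤
      ∑ k, weight R (x k) * ∑ j, (pairPotential Wt k j x + pairPotential Wt j k x) := by
  have hcount : ∑ k : ι, ∑ j : ι, (if j = k then 0 else 1 / 2 : ℝ) / 2 =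
      (Fintype.card ι : ℝ) * (Fintype.card ι - 1) / 4 := by
    have hentry (j k : ι) : (if j = k then 0 else 1 / 2 : ℝ) =
        1 / 2 - if j = k then 1 / 2 else 0 := by
      split_ifs <;> norm_num
    simp only [hentry, ← Finset.sum_div, Finset.sum_sub_distrib, Finset.sum_ite_eq',
      Finset.sum_const, Finset.card_univ, Finset.mem_univ, if_true, nsmul_eq_mul]
    ring
  rw [sum_mul_sum_eq_of_symm fun k j => add_comm _ _, ← hcount]
  gcongr with k _ j
  split_ifs with h
  · simp [h, pairPotential]
  · exact half_le_weight_add_weight_mul_pairPotential ht htR hR hW h hx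

lemma localization_error_le_sum_weight_mul_riccatiPotential (hM : 0 < M) (hZ : 0 ≤ Z) (hR : 1 ≤ R)
    (ht : 0 ≤ t) (htR : t ≤ 4 * R ^ 2) (hV : ∀ j s, Vt j s ≤ 2 / √(1 + s ^ 2))
    (hW : ∀ j l, j < l → ∀ s, s ≠ 0 → 1 / (2 * √(s ^ 2 + t)) ≤ Wt j l s)
    (hN : 1 / (M * R) + 16 * Z * Real.log (2 * R + 1)
      + 16 * Z ^ 2 * Real.log (2 * R + 1) ^ 2 * R * M ≤ (Fintype.card ι : ℝ) - 1)
    {x : ι → ℝ} (hx : ∀ j l, j ≠ l → x j - x l ≠ 0) :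
    (1 / M) * ∑ j, deriv (weight R) (x j) ^ 2 / (4 * weight R (x j)) ≤
      ∑ k, weight R (x k) * riccatiPotential M Z Vt Wt (fun y => 2 * Z * M * damp R y) k x := by
  have hR0 : 0 < R := one_pos.trans_le hR
  set n : ℝ := (Fintype.card ι : ℝ) with hn
  set a := 4 * Z * Real.log (2 * R + 1) + 4 * Z ^ 2 * Real.log (2 * R + 1) ^ 2 * R * M with ha
  have hkinetic : (1 / M) * ∑ j, deriv (weight R) (x j) ^ 2 / (4 * weight R (x j)) ≤
      n * (1 / (4 * M * R)) :=
    calc _ ≤ (1 / M) * ∑ j : ι, 1 / (4 * R) := by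
          gcongr ?_ * ∑ j, ?_ with j
          exact deriv_weight_sq_div_le hR0 _
      _ = n * (1 / (4 * M * R)) := by
          rw [Finset.sum_const, Finset.card_univ, nsmul_eq_mul, hn]
          field_simp
  have hbudget : 1 / (4 * M * R) + a ≤ (n - 1) / 4 :=
    calc 1 / (4 * M * R) + a = (1 / (M * R) + 16 * Z * Real.log (2 * R + 1)
          + 16 * Z ^ 2 * Real.log (2 * R + 1) ^ 2 * R * M) / 4 := by rw [ha]; field_simp; ring
      _ ≤ (n - 1) / 4 := by gcongr
  have hattraction : ∑ k, weight R (x k) * (Z * Vt k (x k)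
      - (1 / M) * (deriv (fun y => 2 * Z * M * damp R y) (x k)
        - (2 * Z * M * damp R (x k)) ^ 2)) ≤ n * a :=
    (Finset.sum_le_sum fun k _ => weight_mul_attraction_le hM hZ hR (hV k _)).trans_eq (by
      rw [Finset.sum_const, Finset.card_univ, nsmul_eq_mul])
  have hrepulsion := le_sum_weight_mul_pairPotential ht htR hR0 hW hx
  calc _ ≤ n * (1 / (4 * M * R)) := hkinetic
    _ ≤ n * (n - 1) / 4 - n * a := by
        have := mul_le_mul_of_nonneg_left hbudget (Nat.cast_nonneg (Fintype.card ι) : 0 ≤ n)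
        linarith
    _ ≤ _ := sub_le_sub hrepulsion hattraction
    _ = _ := by
        rw [← Finset.sum_sub_distrib]
        refine Finset.sum_congr rfl fun k _ => ?_
        rw [riccatiPotential, particlePotential]
        ring

theorem not_hasBoundState_of_le_card [Nonempty ι] (hM : 0 < M) (hZ : 0 ≤ Z) (hR : 1 ≤ R)
    (ht : 0 ≤ t) (htR : t ≤ 4 * R ^ 2) (hVint : ∀ j, LocallyIntegrable (Vt j))
    (hWm : ∀ j l, j < l → Measurable (Wt j l)) (hV : ∀ j s, Vt j s ≤ 2 / √(1 + s ^ 2))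
    (hW : ∀ j l, j < l → ∀ s, s ≠ 0 → 1 / (2 * √(s ^ 2 + t)) ≤ Wt j l s)
    (hN : 1 / (M * R) + 16 * Z * Real.log (2 * R + 1)
      + 16 * Z ^ 2 * Real.log (2 * R + 1) ^ 2 * R * M ≤ (Fintype.card ι : ℝ) - 1) :
    ¬HasBoundState M Z Vt Wt := by
  have hR0 : 0 < R := one_pos.trans_le hR
  refine not_hasBoundState_of_riccatiPotential hM (contDiff_weight hR0) (weight_pos hR0)
    (g := fun y => 2 * Z * M * damp R y) (contDiff_const.mul (contDiff_damp hR0)) hVint hWm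
    (fun j l hjl s hs => le_trans (by positivity) (hW j l hjl s hs)) ?_
  filter_upwards [ae_sub_ne_zero] with x hx using
    localization_error_le_sum_weight_mul_riccatiPotential hM hZ hR ht htR hV hW hN hx

end ManyParticles

section Parameters

open Filter

variable {n u D δ : ℝ}

lemma log_le_two_mul_sqrt {x : ℝ} (hx : 0 ≤ x) : Real.log x ≤ 2 * √x := by
  have h := Real.log_le_rpow_div hx (by norm_num : (0 : ℝ) < 1 / 2)
  rw [← Real.sqrt_eq_rpow] at h
  linarith

lemma log_sq_le_sixteen_mul_sqrt {x : ℝ} (hx : 1 ≤ x) : Real.log x ^ 2 ≤ 16 * √x := by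
  have hlog := log_le_two_mul_sqrt (Real.sqrt_nonneg x)
  rw [Real.log_sqrt (by linarith)] at hlog
  calc Real.log x ^ 2 ≤ (4 * √√x) ^ 2 :=
        pow_le_pow_left₀ (Real.log_nonneg hx) (by linarith) 2
    _ = 16 * √x := by rw [mul_pow, Real.sq_sqrt (Real.sqrt_nonneg x)]; norm_num

lemma eventually_mul_rpow_mul_log_sq_le (C : ℝ) {s : ℝ} (hs : s < 1) :
    ∀ᶠ u : ℝ in atTop, C * (u ^ s * Real.log u ^ 2) ≤ u := by
  have hlog := (isLittleO_log_rpow_rpow_atTop 2 (by linarith : 0 < 1 - s)).bound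
    (by positivity : (0 : ℝ) < 1 / (|C| + 1))
  filter_upwards [hlog, eventually_gt_atTop 0] with u hu hu0
  rw [Real.rpow_two, Real.norm_of_nonneg (sq_nonneg _),
    Real.norm_of_nonneg (Real.rpow_nonneg hu0.le _)] at hu
  calc C * (u ^ s * Real.log u ^ 2)
      ≤ (|C| + 1) * (u ^ s * (1 / (|C| + 1) * u ^ (1 - s))) := by
        gcongr
        linarith [le_abs_self C]
    _ = u ^ s * u ^ (1 - s) := by field_simp
    _ = u := by rw [← Real.rpow_add hu0, add_sub_cancel, Real.rpow_one]

lemma one_le_log_of_four_le (hu : 4 ≤ u) : 1 ≤ Real.log u := by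
  rw [Real.le_log_iff_exp_le (by linarith)]
  linarith [Real.exp_one_lt_d9]

lemma log_scale_le (hn : 1 ≤ n) (hD : 0 ≤ D) (hDδ : D ≤ δ * √n) (hu : 16 ≤ u)
    (hδ : 1024 * δ ≤ u) :
    Real.log (2 * (4 * u / n + D) + 1) ≤ 2 * Real.log u + Real.log n / 2 := by
  have hn0 : 0 < n := by linarith
  have : 0 < u := by linarith
  have hsqrt : 1 ≤ √n := Real.one_le_sqrt.2 hn
  have hratio : 4 * u / n ≤ 4 * u * √n :=
    (div_le_self (by positivity) hn).trans (le_mul_of_one_le_right (by positivity) hsqrt)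
  have hδn : 1024 * (δ * √n) ≤ u * √n := by
    rw [← mul_assoc]
    gcongr
  have hsq : 16 * (u * √n) ≤ u * (u * √n) := by gcongr
  have hone : 1 ≤ u * √n := one_le_mul_of_one_le_of_one_le (by linarith) hsqrt
  have hscale : 0 < 2 * (4 * u / n + D) + 1 := by positivity
  calc Real.log (2 * (4 * u / n + D) + 1) ≤ Real.log (u ^ 2 * √n) :=
        Real.log_le_log hscale (by linarith)
    _ = 2 * Real.log u + Real.log n / 2 := by
        rw [Real.log_mul (by positivity) (by positivity), Real.log_pow, Real.log_sqrt hn0.le,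
          Nat.cast_ofNat]

lemma log_scale_sq_mul_le (hn : 1 ≤ n) (hD : 1 ≤ D) (hDδ : D ≤ δ * √n) (hu : 16 ≤ u)
    (hδ : 1024 * δ ≤ u) (hδlog : 1024 * (δ * Real.log u ^ 2) ≤ u) :
    64 * Real.log (2 * (4 * u / n + D) + 1) ^ 2 * D ≤ n * u := by
  have hn0 : 0 < n := by linarith
  have hsqrt : 1 ≤ √n := Real.one_le_sqrt.2 hn
  have hnn : √n * √n = n := Real.mul_self_sqrt hn0.le
  have : 0 ≤ δ := nonneg_of_mul_nonneg_left (by linarith) (by linarith : 0 < √n)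
  have hL0 : 0 ≤ Real.log (2 * (4 * u / n + D) + 1) := by
    have : 0 < 4 * u / n := by positivity
    exact Real.log_nonneg (by linarith)
  set L := Real.log (2 * (4 * u / n + D) + 1)
  have hL : L ^ 2 ≤ 8 * Real.log u ^ 2 + 8 * √n :=
    calc L ^ 2 ≤ (2 * Real.log u + Real.log n / 2) ^ 2 :=
          pow_le_pow_left₀ hL0 (log_scale_le hn (by linarith) hDδ hu hδ) 2
      _ ≤ 2 * ((2 * Real.log u) ^ 2 + (Real.log n / 2) ^ 2) := add_sq_le
      _ ≤ 8 * Real.log u ^ 2 + 8 * √n := by linarith [log_sq_le_sixteen_mul_sqrt hn]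
  calc 64 * L ^ 2 * D ≤ 64 * (8 * Real.log u ^ 2 + 8 * √n) * (δ * √n) := by gcongr
    _ = (1024 * (δ * Real.log u ^ 2)) * √n / 2 + (1024 * δ) * (√n * √n) / 2 := by ring
    _ ≤ u * (√n * √n) / 2 + u * (√n * √n) / 2 := by
        gcongr
        exact le_mul_of_one_le_right (by linarith) hsqrt
    _ = n * u := by rw [hnn]; ring

lemma binding_budget_le (hn : 2 ^ 20 * Real.log u ≤ n) (hu : 16 ≤ u) (hD : 1 ≤ D)
    (hDδ : D ≤ δ * √n) (hδlog : 1024 * (δ * Real.log u ^ 2) ≤ u) :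
    u / (4 * u / n + D) + 16 * Real.log (2 * (4 * u / n + D) + 1)
      + 16 * Real.log (2 * (4 * u / n + D) + 1) ^ 2 * (4 * u / n + D) / u ≤ 3 / 4 * n := by
  have hlog : 1 ≤ Real.log u := one_le_log_of_four_le (by linarith)
  have hn1 : 2 ^ 20 ≤ n := by linarith
  have hn0 : 0 < n := by linarith
  have hδ0 : 0 ≤ δ := nonneg_of_mul_nonneg_left (by linarith) (Real.sqrt_pos.2 hn0)
  have hδ : 1024 * δ ≤ u := by
    nlinarith [mul_le_mul_of_nonneg_left (one_le_pow₀ hlog : 1 ≤ Real.log u ^ 2) hδ0]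
  have hL := log_scale_le (by linarith) (by linarith) hDδ hu hδ
  have hLD := log_scale_sq_mul_le (by linarith) hD hDδ hu hδ hδlog
  have hL0 : 0 ≤ Real.log (2 * (4 * u / n + D) + 1) := by
    have : 0 < 4 * u / n := by positivity
    exact Real.log_nonneg (by linarith)
  set L := Real.log (2 * (4 * u / n + D) + 1)
  have hLn : 256 * L ≤ n := by
    have hsqrt : 2 ^ 10 ≤ √n := Real.le_sqrt_of_sq_le (by linarith)
    have hnn : √n * √n = n := Real.mul_self_sqrt hn0.le
    nlinarith [log_le_two_mul_sqrt hn0.le]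
  have hkinetic : u / (4 * u / n + D) ≤ n / 4 :=
    calc u / (4 * u / n + D) ≤ u / (4 * u / n) := by gcongr; linarith
      _ = n / 4 := by field_simp
  have hsq : 16 * L ^ 2 * (4 * u / n + D) / u = 64 * L ^ 2 / n + 16 * L ^ 2 * D / u := by
    field_simp
    ring
  have hratio : 64 * L ^ 2 / n ≤ n / 16 := by
    rw [div_le_iff₀ hn0]
    nlinarith
  have hquad : 16 * L ^ 2 * D / u ≤ n / 4 := by
    rw [div_le_iff₀ (by linarith)]
    linarith
  rw [hsq]
  linarith

lemma sqrt_le_rpow_of_rpow_le_sq {Z γ : ℝ} (hZ : 0 ≤ Z) (hγ : 2 < γ) (hu : 0 ≤ u)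
    (h : Z ^ (γ - 2) ≤ u ^ 2) : √Z ≤ u ^ (1 / (γ - 2)) := by
  rw [one_div, Real.le_rpow_inv_iff_of_pos (Real.sqrt_nonneg Z) hu (by linarith)]
  refine le_of_sq_le_sq ?_ hu
  rwa [← Real.rpow_natCast, ← Real.rpow_mul (Real.sqrt_nonneg Z), mul_comm, Real.rpow_mul
    (Real.sqrt_nonneg Z), Real.rpow_natCast, Real.sq_sqrt hZ]

end Parameters

section Thresholds

variable {K γ N Z u U B : ℝ} {ν : ℕ}

lemma le_of_sq_mul_rpow_le_sq (hγ : 2 ≤ γ) (hZ : 1 ≤ Z) (hu : 0 ≤ u)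
    (h : U ^ 2 * Z ^ (γ - 2) ≤ u ^ 2) : U ≤ u :=
  le_of_sq_le_sq ((le_mul_of_one_le_right (sq_nonneg U)
    (Real.one_le_rpow hZ (by linarith))).trans h) hu

lemma one_add_sqrt_le_mul_sqrt (hN : 1 ≤ N) (hν : (ν : ℝ) ≤ K * N) :
    1 + √ν ≤ (1 + √|K|) * √N := by
  have hK : √ν ≤ √|K| * √N := by
    rw [← Real.sqrt_mul (abs_nonneg K)]
    exact Real.sqrt_le_sqrt (hν.trans (by gcongr; exact le_abs_self K))
  linarith [Real.one_le_sqrt.2 hN]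

lemma exists_threshold (K γ : ℝ) :
    ∃ U ≥ (16 : ℝ), ∀ {N Z u : ℝ} {ν : ℕ},
      ((2 < γ ∧ (ν : ℝ) ≤ K) ∨ (3 < γ ∧ (ν : ℝ) ≤ K * N)) → 1 ≤ Z → Z ≤ N → 0 ≤ u →
      U ^ 2 * Z ^ (γ - 2) ≤ u ^ 2 →
      ∃ δ, 1 + √ν ≤ δ * √(N / Z) ∧ 1024 * (δ * Real.log u ^ 2) ≤ u := by
  obtain ⟨s, hs, hsγ⟩ : ∃ s < 1, 0 ≤ s ∧ (3 < γ → s = 1 / (γ - 2)) := by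
    by_cases hγ : 3 < γ
    · have : 0 < γ - 2 := by linarith
      exact ⟨_, (div_lt_one this).2 (by linarith), by positivity, fun _ => rfl⟩
    · exact ⟨0, one_pos, le_rfl, fun h => absurd h hγ⟩
  obtain ⟨U, hU⟩ := Filter.eventually_atTop.1
    (eventually_mul_rpow_mul_log_sq_le (1024 * (1 + √|K|)) hs)
  refine ⟨max 16 U, le_max_left _ _, fun {N Z u ν} hν hZ hZN hu hUu => ?_⟩
  have hγ : 2 < γ := by rcases hν with h | h <;> linarith [h.1]
  have hmax : max 16 U ≤ u := le_of_sq_mul_rpow_le_sq hγ.le hZ hu hUu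
  have hu1 : 1 ≤ u := by linarith [(le_max_left 16 U).trans hmax]
  have hlog := hU u ((le_max_right _ _).trans hmax)
  have hn : 1 ≤ N / Z := (one_le_div (by linarith)).2 hZN
  suffices h : ∃ δ ≤ (1 + √|K|) * u ^ s, 1 + √ν ≤ δ * √(N / Z) by
    obtain ⟨δ, hδu, hδ⟩ := h
    refine ⟨δ, hδ, le_trans ?_ hlog⟩
    rw [mul_assoc 1024, ← mul_assoc (1 + √|K|)]
    gcongr
  rcases hν with ⟨-, hν⟩ | ⟨hγ3, hν⟩
  · have hK : K ≤ |K| * (N / Z) :=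
      (le_abs_self K).trans (le_mul_of_one_le_right (abs_nonneg K) hn)
    refine ⟨1 + √|K|, le_mul_of_one_le_right (by positivity) (Real.one_le_rpow hu1 hsγ.1), ?_⟩
    simpa only [abs_abs] using one_add_sqrt_le_mul_sqrt hn (hν.trans hK)
  · refine ⟨(1 + √|K|) * √Z, ?_, ?_⟩
    · rw [hsγ.2 hγ3]
      gcongr
      refine sqrt_le_rpow_of_rpow_le_sq (by linarith) hγ hu
        ((le_mul_of_one_le_left (by positivity) (one_le_pow₀ ?_)).trans hUu)
      linarith [le_max_left 16 U]
    · rw [mul_assoc, ← Real.sqrt_mul (by linarith), mul_div_cancel₀ _ (by linarith)]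
      exact one_add_sqrt_le_mul_sqrt (hZ.trans hZN) hν

lemma abs_log_sq_div (hB : 0 ≤ B) (hBZ : 1 ≤ √B / Z) :
    |Real.log (Z ^ 2 / B)| = 2 * Real.log (√B / Z) := by
  have hinv : Z ^ 2 / B = ((√B / Z) ^ 2)⁻¹ := by rw [div_pow, Real.sq_sqrt hB, inv_div]
  rw [hinv, Real.log_inv, abs_neg, Real.log_pow, Nat.cast_ofNat,
    abs_of_nonneg (mul_nonneg zero_le_two (Real.log_nonneg hBZ))]

lemma half_le_log_of_rpow_le_of_lt_exp {a ε : ℝ} (hγ : 0 ≤ γ) (hZ : 1 ≤ Z) (ha : 0 < a)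
    (hε : 0 ≤ ε) (hB : a * Z ^ γ ≤ B) (hBexp : B < a * Real.exp (-2) * Real.exp (Z ^ (1 / 2 - ε))) :
    1 / 2 ≤ Real.log Z := by
  suffices hZ2 : 2 ≤ Z by
    linarith [Real.log_le_log two_pos hZ2, Real.log_two_gt_d9]
  by_contra! hZ2
  have hroot : Z ^ (1 / 2 - ε) ≤ 2 :=
    calc Z ^ (1 / 2 - ε) ≤ Z ^ (1 : ℝ) := Real.rpow_le_rpow_of_exponent_le hZ (by linarith)
      _ ≤ 2 := by rw [Real.rpow_one]; exact hZ2.le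
  have hlower : a ≤ a * Z ^ γ := le_mul_of_one_le_right ha.le (Real.one_le_rpow hZ hγ)
  have hupper : a * Real.exp (-2) * Real.exp (Z ^ (1 / 2 - ε)) ≤ a := by
    rw [mul_assoc, ← Real.exp_add]
    exact mul_le_of_le_one_right ha.le (Real.exp_le_one_iff.2 (by linarith))
  linarith

end Thresholds

section StrongField

variable {ι : Type} [Fintype ι] [LinearOrder ι] {μ ν : ℕ} {Z B δ : ℝ} {Vt : ι → ℝ → ℝ}
  {Wt : ι → ι → ℝ → ℝ}

lemma not_hasBoundState_of_le_V (hZ : 1 ≤ Z) (hB : 0 < B)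
    (hVint : ∀ j, LocallyIntegrable (Vt j)) (hWm : ∀ j k, j < k → Measurable (Wt j k))
    (hV : ∀ j x, Vt j x ≤ V μ x)
    (hW : ∀ j k, j < k → ∀ x, x ≠ 0 → (1 / √2) * VPred ν (x / √2) ≤ Wt j k x)
    (hu : 16 ≤ √B / Z) (hN : 2 ^ 20 * Real.log (√B / Z) ≤ Fintype.card ι / Z)
    (hδ : 1 + √ν ≤ δ * √(Fintype.card ι / Z))
    (hδlog : 1024 * (δ * Real.log (√B / Z) ^ 2) ≤ √B / Z) :
    ¬HasBoundState (B ^ (-(1 / 2) : ℝ)) Z Vt Wt := by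
  have hZ0 : 0 < Z := by linarith
  have hν : 0 ≤ √(ν : ℝ) := Real.sqrt_nonneg _
  set n : ℝ := Fintype.card ι / Z with hn
  set u := √B / Z with hudef
  have hn20 : 2 ^ 20 ≤ n := by linarith [one_le_log_of_four_le (u := u) (by linarith)]
  have hcard : (Fintype.card ι : ℝ) = Z * n := by rw [hn]; field_simp
  have hN4 : 4 ≤ Z * n := by nlinarith
  have : Nonempty ι := Fintype.card_pos_iff.1 (by
    rw [← Nat.cast_pos (α := ℝ), hcard]; linarith)
  have hM : B ^ (-(1 / 2) : ℝ) = 1 / (Z * u) := by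
    rw [Real.rpow_neg hB.le, ← Real.sqrt_eq_rpow, hudef, mul_div_cancel₀ _ hZ0.ne', one_div]
  have hR : 1 + √ν ≤ 4 * u / n + (1 + √ν) := le_add_of_nonneg_left (by positivity)
  refine not_hasBoundState_of_le_card (R := 4 * u / n + (1 + √ν)) (t := 2 * ν) (by positivity)
    hZ0.le (by linarith) (by positivity) ?_ hVint hWm (fun j s => (hV j s).trans (V_le μ s))
    (fun j k h s hs => (le_VPred ν hs).trans (hW j k h s hs)) ?_
  · have := Real.sq_sqrt (Nat.cast_nonneg ν : (0 : ℝ) ≤ ν)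
    nlinarith
  · have hbudget := binding_budget_le hN hu (by linarith) hδ hδlog
    rw [hM, hcard]
    generalize 4 * u / n + (1 + √ν) = R at *
    have hR0 : 0 < R := by linarith
    calc _ = Z * (u / R + 16 * Real.log (2 * R + 1) + 16 * Real.log (2 * R + 1) ^ 2 * R / u) := by
          field_simp
      _ ≤ Z * (3 / 4 * n) := by gcongr
      _ ≤ Z * n - 1 := by linarith

end StrongField

end LandauModel

end

theorem theorem2_general (K γ : ℝ) :
    ∃ A > (0 : ℝ), ∃ a₂ > (0 : ℝ),
      ∀ (ι : Type) [Fintype ι] [LinearOrder ι] (μ ν : ℕ) (Z B : ℝ)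
        (Vt : ι → ℝ → ℝ) (Wt : ι → ι → ℝ → ℝ),
        ((2 < γ ∧ (ν : ℝ) ≤ K) ∨ (3 < γ ∧ (ν : ℝ) ≤ K * Fintype.card ι)) →
        (∀ j, LocallyIntegrable (Vt j)) →
        (∀ j k, j < k → Measurable (Wt j k)) →
        (∀ j x, Vt j x ≤ LandauModel.V μ x) →
        (∀ j k, j < k → ∀ x, x ≠ 0 →
          (1 / √2) * LandauModel.VPred ν (x / √2) ≤ Wt j k x) →
        1 ≤ Z →
        a₂ * Z ^ γ ≤ B →
        A * Z * |Real.log (Z ^ 2 / B)| ≤ Fintype.card ι →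
        ¬LandauModel.HasBoundState (B ^ (-(1 / 2) : ℝ)) Z Vt Wt := by
  obtain ⟨U, hU16, hU⟩ := LandauModel.exists_threshold K γ
  refine ⟨2 ^ 20, by norm_num, U ^ 2, by positivity,
    fun ι _ _ μ ν Z B Vt Wt hν hVint hWm hV hW hZ hB hN => ?_⟩
  have hγ : 2 < γ := by rcases hν with h | h <;> linarith [h.1]
  have hZ0 : 0 < Z := by linarith
  have hB0 : 0 < B := lt_of_lt_of_le (by positivity) hB
  have hUu : U ^ 2 * Z ^ (γ - 2) ≤ (√B / Z) ^ 2 := by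
    rw [div_pow, Real.sq_sqrt hB0.le, le_div_iff₀ (by positivity), mul_assoc, ← Real.rpow_two Z,
      ← Real.rpow_add hZ0, sub_add_cancel]
    exact hB
  have hu : U ≤ √B / Z := LandauModel.le_of_sq_mul_rpow_le_sq hγ.le hZ (by positivity) hUu
  have hlog : 1 ≤ Real.log (√B / Z) := LandauModel.one_le_log_of_four_le (by linarith)
  rw [LandauModel.abs_log_sq_div hB0.le (by linarith)] at hN
  have hNZ : 2 ^ 20 * Real.log (√B / Z) ≤ Fintype.card ι / Z := by
    rw [le_div_iff₀ hZ0]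
    nlinarith
  have hZN : Z ≤ Fintype.card ι := (one_le_div hZ0).1 (by linarith)
  obtain ⟨δ, hδ, hδlog⟩ := hU hν hZ hZN (by positivity) hUu
  exact LandauModel.not_hasBoundState_of_le_V hZ hB0 hVint hWm hV hW (hU16.trans hu) hNZ hδ hδlog

theorem theorem2 (K γ : ℝ) :
    ∃ A > (0 : ℝ), ∃ a₂ > (0 : ℝ), ∀ ε > (0 : ℝ), ∃ aε > (0 : ℝ),
      ∀ (N μ ν : ℕ) (Z B : ℝ)
        (Vt : Fin N → ℝ → ℝ) (Wt : Fin N → Fin N → ℝ → ℝ),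
        ((2 < γ ∧ (ν : ℝ) ≤ K) ∨ (3 < γ ∧ (ν : ℝ) ≤ K * N)) →
        ν ≤ 2 * μ →
        (∀ j, Measurable (Vt j)) →
        (∀ j, LocallyIntegrable (Vt j)) →
        (∀ j k, j < k → Measurable (Wt j k)) →
        (∀ j k, j < k → LocallyIntegrableOn (Wt j k) {0}ᶜ) →
        (∀ j x, Vt j x ≤ LandauModel.V μ x) →
        (∀ j k, j < k → ∀ x, x ≠ 0 →
          (1 / Real.sqrt 2) * LandauModel.VPred ν (x / Real.sqrt 2) ≤ Wt j k x) →
        1 ≤ Z →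
        a₂ * Z ^ γ ≤ B →
        B < aε * Real.exp (Z ^ (1 / 2 - ε)) →
        3 * Z + 1 + A * Z * Real.log Z * |Real.log (Z ^ 2 / B)| < (N : ℝ) →
        ¬ LandauModel.HasBoundState (B ^ (-(1 / 2) : ℝ)) Z Vt Wt := by
  obtain ⟨A, hA, a₂, ha₂, hgeneral⟩ := theorem2_general K γ
  refine ⟨2 * A, by positivity, a₂, ha₂, fun ε hε => ⟨a₂ * Real.exp (-2), by positivity, ?_⟩⟩
  intro N μ ν Z B Vt Wt hν _ _ hVint hWm _ hV hW hZ hB hBexp hN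
  have hγ : 0 ≤ γ := by rcases hν with h | h <;> linarith [h.1]
  have hlogZ : 1 / 2 ≤ Real.log Z :=
    LandauModel.half_le_log_of_rpow_le_of_lt_exp hγ hZ ha₂ hε.le hB hBexp
  refine hgeneral (Fin N) μ ν Z B Vt Wt (by simpa only [Fintype.card_fin] using hν) hVint hWm
    hV hW hZ hB ?_
  rw [Fintype.card_fin]
  calc A * Z * |Real.log (Z ^ 2 / B)|
      = 2 * A * Z * (1 / 2) * |Real.log (Z ^ 2 / B)| := by ring
    _ ≤ 2 * A * Z * Real.log Z * |Real.log (Z ^ 2 / B)| := by gcongr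
    _ ≤ N := by linarith
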